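/- Let $\Sigma$ be a smooth surface, possibly with boundary, let $\mathbf r:\Sigma\to\mathbb R^3$ be a smooth immersion with a smooth unit normal field $\mathbf n$, and give $\Sigma$ the induced metric $g$, with Levi-Civita connection $\nabla$. Let $h(v,w)=-\langle D_v\mathbf n,w\rangle$ be the second fundamental form, $S$ the shape operator, determined by $g(Sv,w)=h(v,w)$, $H=\operatorname{tr}S$ the mean curvature (the sum of the principal curvatures) and $K=\det S$ the Gaussian curvature. Let $F$ be a smooth real function of two variables on an open subset of $\mathbb R^2$ that contains all values $(H(p),K(p))$, $p\in\Sigma$; write $F,F_H,F_K$ for the functions $F(H,K)$, $\partial_1F(H,K)$, $\partial_2F(H,K)$ on $\Sigma$. Put $$W=\Delta F_H+H\Delta F_K-\langle h,\mathrm{Hess}\,F_K\rangle+F_H|h|^2+HKF_K-HF,$$ $$T=F_KS^2-(F_H+HF_K)S+\big(S(\nabla F_K)-\nabla F_H-H\nabla F_K\big)\otimes\mathbf n+F\,\nabla\mathbf r.$$ Here $T$ is regarded as a field of linear maps $T_p:\mathbb R^3\to T_p\Sigma$, where $S(e)$ means $S(e^\top)$ with $e^\top$ the tangential part of $e\in\mathbb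 R^3$, $(Z\otimes\mathbf n)(e)=\langle\mathbf n,e\rangle Z$, and $(\nabla\mathbf r)(e)=e^\top$; its divergence $\mathrm{div}_g T$ is the $\mathbb R^3$-valued function determined by $\langle e,\mathrm{div}_gT\rangle=\mathrm{div}_g(Te)$ for every constant vector $e\in\mathbb R^3$. The surface is called a $\mathcal W$-surface (stationary for $\mathcal W=\int_\Sigma F(H,K)\,d\mu$) if it satisfies the Euler–Lagrange equation $W=0$ on $\Sigma$. Then $$\mathrm{div}_g\,T=-W\,\mathbf n\quad\text{on }\Sigma .$$ In particular, $\Sigma$ is a $\mathcal W$-surface if and only if $\mathrm{div}_g\,T=0$ on $\Sigma$. -/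

import Mathlib

open scoped Manifold ContDiff

noncomputable section

namespace ImmersedSurface

/-- The Euclidean plane, on which the surface is modelled. -/
abbrev E2 : Type := EuclideanSpace ℝ (Fin 2)

/-- The ambient Euclidean space `ℝ³`. -/
abbrev E3 : Type := EuclideanSpace ℝ (Fin 3)

variable {H₀ : Type*} [TopologicalSpace H₀] (I : ModelWithCorners ℝ E2 H₀)
  {M : Type*} [TopologicalSpace M] [ChartedSpace H₀ M]

/-! ### The class of immersed surfaces -/

/-- `r` is a smooth immersion of the surface `M` (possibly with boundary) into `ℝ³` and `n` is a
smooth unit normal field along it. The surface carries the metric induced by `r`, and it is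
oriented by `n`. -/
structure IsImmersionWithNormal (r n : M → E3) : Prop where
  smooth_immersion : ContMDiff I 𝓘(ℝ, E3) ∞ r
  injective_deriv : ∀ p : M, Function.Injective (mvfderiv I r p)
  smooth_normal : ContMDiff I 𝓘(ℝ, E3) ∞ n
  norm_normal : ∀ p : M, ‖n p‖ = 1
  orthogonal_normal : ∀ (p : M) (v : TangentSpace I p), inner ℝ (mvfderiv I r p v) (n p) = 0

/-! ### Pointwise linear algebra on the tangent planes -/

/-- The coordinate basis `∂₁, ∂₂` of `T_pM` given by the preferred chart at `p` (the tangent space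
at `p` is identified with the model space through this chart). -/
def tangentBasis (p : M) : Module.Basis (Fin 2) ℝ (TangentSpace I p) :=
  (EuclideanSpace.basisFun (Fin 2) ℝ).toBasis

/-- The induced metric `g(v, w) = ⟨dr(v), dr(w)⟩`. -/
def metric (r : M → E3) (p : M) : TangentSpace I p →ₗ[ℝ] TangentSpace I p →ₗ[ℝ] ℝ :=
  (innerₗ E3).compl₁₂ (mvfderiv I r p : TangentSpace I p →ₗ[ℝ] E3)
    (mvfderiv I r p : TangentSpace I p →ₗ[ℝ] E3)

/-- The inverse metric matrix `g^{ij}` at `p`. -/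
def invGram (r : M → E3) (p : M) : Matrix (Fin 2) (Fin 2) ℝ :=
  (Matrix.of fun i j => metric I r p (tangentBasis I p i) (tangentBasis I p j))⁻¹

/-- The musical isomorphism `♯ : T_p^*M → T_pM`, that is `α ↦ ∑ g^{ij} α(∂_j) ∂_i`; the vector
`♯α` is determined by `g(♯α, w) = α(w)`. -/
def sharp (r : M → E3) (p : M) :
    Module.Dual ℝ (TangentSpace I p) →ₗ[ℝ] TangentSpace I p :=
  Matrix.toLin (tangentBasis I p).dualBasis (tangentBasis I p) (invGram I r p)

/-- The second fundamental form `h(v, w) = -⟨D_v n, w⟩`. -/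
def secondForm (r n : M → E3) (p : M) :
    TangentSpace I p →ₗ[ℝ] TangentSpace I p →ₗ[ℝ] ℝ :=
  -(innerₗ E3).compl₁₂ (mvfderiv I n p : TangentSpace I p →ₗ[ℝ] E3)
    (mvfderiv I r p : TangentSpace I p →ₗ[ℝ] E3)

/-- The shape operator `S`, determined by `g(S v, w) = h(v, w)`. -/
def shape (r n : M → E3) (p : M) : TangentSpace I p →ₗ[ℝ] TangentSpace I p :=
  sharp I r p ∘ₗ secondForm I r n p

/-- The mean curvature `H = tr_g h = κ₁ + κ₂`. -/
def meanCurv (r n : M → E3) (p : M) : ℝ := LinearMap.trace ℝ _ (shape I r n p)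

/-- The Gaussian curvature `K = det h / det g = κ₁ κ₂`. -/
def gaussCurv (r n : M → E3) (p : M) : ℝ := LinearMap.det (shape I r n p)

/-- The inner product `⟨A, B⟩ = g^{ik} g^{jl} A_{ij} B_{kl}` of bilinear forms on `T_pM`. -/
def formInner (r : M → E3) (p : M)
    (A B : TangentSpace I p →ₗ[ℝ] TangentSpace I p →ₗ[ℝ] ℝ) : ℝ :=
  ∑ i, ∑ j, ∑ k, ∑ l, invGram I r p i k * invGram I r p j l *
    A (tangentBasis I p i) (tangentBasis I p j) * B (tangentBasis I p k) (tangentBasis I p l)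

/-- The tangential part `e^⊤ ∈ T_pM` of a vector `e` of `ℝ³`: `g(e^⊤, w) = ⟨e, dr(w)⟩`. -/
def tangentialPart (r : M → E3) (p : M) : E3 →ₗ[ℝ] TangentSpace I p :=
  sharp I r p ∘ₗ (innerₗ E3).compl₁₂ LinearMap.id (mvfderiv I r p : TangentSpace I p →ₗ[ℝ] E3)

/-! ### The Levi-Civita connection and its differential operators

The connection is given by the Christoffel symbols of the induced metric in the preferred chart
`φ` at `p`. Derivatives are taken within the range of the model, as usual for manifolds with
boundary. -/

/-- The partial derivative `∂_i f` on the coordinate domain. -/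
def coordDeriv {V : Type*} [NormedAddCommGroup V] [NormedSpace ℝ V]
    (f : E2 → V) (i : Fin 2) (x : E2) : V :=
  fderivWithin ℝ f (Set.range I) x (EuclideanSpace.single i 1)

/-- The components `g_{ij} = ⟨∂_i(r ∘ φ⁻¹), ∂_j(r ∘ φ⁻¹)⟩` of the metric in the chart `φ` at `p`. -/
def chartMetric (r : M → E3) (p : M) (i j : Fin 2) (x : E2) : ℝ :=
  inner ℝ (coordDeriv I (r ∘ (extChartAt I p).symm) i x)
    (coordDeriv I (r ∘ (extChartAt I p).symm) j x)

/-- The Christoffel symbols `Γ^k_{ij} = ½ g^{kl} (∂_i g_{jl} + ∂_j g_{il} - ∂_l g_{ij})` in the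
chart `φ` at `p`. -/
def christoffel (r : M → E3) (p : M) (k i j : Fin 2) (x : E2) : ℝ :=
  (1 / 2) * ∑ l, (Matrix.of fun a b => chartMetric I r p a b x)⁻¹ k l *
    (coordDeriv I (chartMetric I r p j l) i x + coordDeriv I (chartMetric I r p i l) j x
      - coordDeriv I (chartMetric I r p i j) l x)

/-- The components `X^k` of a vector field in the chart `φ` at `p`: the `k`-th coordinate of
`dφ(X)`, as a function on the coordinate domain. -/
def chartField (X : Π q : M, TangentSpace I q) (p : M) (k : Fin 2) (x : E2) : ℝ :=
  (mvfderiv I (extChartAt I p) ((extChartAt I p).symm x) (X ((extChartAt I p).symm x))) k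

/-- The covariant derivative `v ↦ ∇_v X` at `p` for the Levi-Civita connection of the induced
metric: `(∇_{∂_i} X)^k = ∂_i X^k + Γ^k_{ij} X^j`. -/
def covDeriv (r : M → E3) (X : Π q : M, TangentSpace I q) (p : M) :
    TangentSpace I p →ₗ[ℝ] TangentSpace I p :=
  Matrix.toLin (tangentBasis I p) (tangentBasis I p) (Matrix.of fun k i =>
    coordDeriv I (chartField I X p k) i (extChartAt I p p) +
      ∑ j, christoffel I r p k i j (extChartAt I p p) * chartField I X p j (extChartAt I p p))

/-- The divergence `div_g X = tr (v ↦ ∇_v X)`. -/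
def divergence (r : M → E3) (X : Π q : M, TangentSpace I q) (p : M) : ℝ :=
  LinearMap.trace ℝ _ (covDeriv I r X p)

/-- The gradient `∇f = ♯(df)`. -/
def grad (r : M → E3) (f : M → ℝ) (p : M) : TangentSpace I p :=
  sharp I r p (mvfderiv I f p : TangentSpace I p →ₗ[ℝ] ℝ)

/-- The Hessian `Hess f (v, w) = g(∇_v ∇f, w)`. -/
def hess (r : M → E3) (f : M → ℝ) (p : M) :
    TangentSpace I p →ₗ[ℝ] TangentSpace I p →ₗ[ℝ] ℝ :=
  metric I r p ∘ₗ covDeriv I r (grad I r f) p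

/-- The Laplace-Beltrami operator `Δf = div_g ∇f`. -/
def laplacian (r : M → E3) (f : M → ℝ) (p : M) : ℝ := divergence I r (grad I r f) p

/-- The divergence of a tensor field `T : ℝ³ → T_pM`, the vector of `ℝ³` determined by
`⟨e, div_g T⟩ = div_g (T e)` for constant `e`. -/
def tensorDiv (r : M → E3) (T : Π q : M, E3 →ₗ[ℝ] TangentSpace I q) (p : M) : E3 :=
  ∑ a : Fin 3, divergence I r (fun q => T q (EuclideanSpace.single a 1)) p •
    EuclideanSpace.single a (1 : ℝ)

/-! ### The curvature functional -/

/-- The Lagrangian `F(H, K)` along the surface. -/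
def lagr (r n : M → E3) (F : ℝ × ℝ → ℝ) (p : M) : ℝ :=
  F (meanCurv I r n p, gaussCurv I r n p)

/-- `F_H` along the surface: the partial derivative in the first variable at `(H, K)`. -/
def lagrH (r n : M → E3) (F : ℝ × ℝ → ℝ) (p : M) : ℝ :=
  deriv (fun t => F (t, gaussCurv I r n p)) (meanCurv I r n p)

/-- `F_K` along the surface: the partial derivative in the second variable at `(H, K)`. -/
def lagrK (r n : M → E3) (F : ℝ × ℝ → ℝ) (p : M) : ℝ :=
  deriv (fun t => F (meanCurv I r n p, t)) (gaussCurv I r n p)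

/-- The Euler-Lagrange expression
`W = Δ F_H + H Δ F_K - ⟨h, Hess F_K⟩ + F_H |h|² + H K F_K - H F`. -/
def eulerLagrange (r n : M → E3) (F : ℝ × ℝ → ℝ) (p : M) : ℝ :=
  laplacian I r (lagrH I r n F) p + meanCurv I r n p * laplacian I r (lagrK I r n F) p
    - formInner I r p (secondForm I r n p) (hess I r (lagrK I r n F) p)
    + lagrH I r n F p * formInner I r p (secondForm I r n p) (secondForm I r n p)
    + meanCurv I r n p * gaussCurv I r n p * lagrK I r n F p
    - meanCurv I r n p * lagr I r n F p

/-- The surface is stationary for `∫ F(H, K) dμ`: it satisfies the Euler-Lagrange equation. -/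
def IsWSurface (r n : M → E3) (F : ℝ × ℝ → ℝ) : Prop :=
  ∀ p : M, eulerLagrange I r n F p = 0

/-- The stress tensor
`T = F_K S² - (F_H + H F_K) S + (S(∇F_K) - ∇F_H - H ∇F_K) ⊗ n + F ∇r`, as a linear map
`ℝ³ → T_pM`. Here `S e` means `S (e^⊤)`, `(Z ⊗ n) e = ⟨n, e⟩ Z`, and `∇r` is the map `e ↦ e^⊤`,
since `∇_v r = v` for tangent vectors `v`. -/
def stress (r n : M → E3) (F : ℝ × ℝ → ℝ) (p : M) : E3 →ₗ[ℝ] TangentSpace I p :=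
  lagrK I r n F p • (shape I r n p ∘ₗ shape I r n p ∘ₗ tangentialPart I r p)
    - (lagrH I r n F p + meanCurv I r n p * lagrK I r n F p) •
        (shape I r n p ∘ₗ tangentialPart I r p)
    + (innerₗ E3 (n p)).smulRight
        (shape I r n p (grad I r (lagrK I r n F) p) - grad I r (lagrH I r n F) p
          - meanCurv I r n p • grad I r (lagrK I r n F) p)
    + lagr I r n F p • tangentialPart I r p

end ImmersedSurface

end

/-!
Extending differentials by zero along the normal turns derivatives on `Σ` into linear maps on the
fixed space `ℝ³`: put `D f e = df(e^⊤)`. Then `S` becomes the field `A = -D n` of endomorphisms of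
`ℝ³`, the Codazzi equation is the statement that `D (D n)` is symmetric up to normal terms, and
Gauss's formula for the Levi-Civita connection gives `div_g X = tr D(dr X)`, so that every
divergence is the trace of an ordinary derivative.

By the Cayley-Hamilton identity `S² = H S - K` the tensor `T` depends only linearly on `S` in
tangential directions: `dr(T e) = (F - K F_K) e^⊤ - F_H A e + ⟨n, e⟩ Z`, where
`Z = A ∇F_K - ∇F_H - H ∇F_K`. Taking the divergence term by term, the tangential contributions
cancel because `dF = F_H dH + F_K dK`, and the coefficient of `⟨n, e⟩` that remains is `-W`.
-/

noncomputable section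

namespace ImmersedSurface

section ManifoldCalculus

variable {𝕜 : Type*} [NontriviallyNormedField 𝕜]
  {X : Type*} [NormedAddCommGroup X] [NormedSpace 𝕜 X]
  {H : Type*} [TopologicalSpace H] {I : ModelWithCorners 𝕜 X H}
  {M : Type*} [TopologicalSpace M] [ChartedSpace H M]
  {E F G : Type*} [NormedAddCommGroup E] [NormedSpace 𝕜 E] [NormedAddCommGroup F]
  [NormedSpace 𝕜 F] [NormedAddCommGroup G] [NormedSpace 𝕜 G]

theorem uniqueDiffWithinAt_range (I : ModelWithCorners 𝕜 X H) (p : M) :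
    UniqueDiffWithinAt 𝕜 (Set.range I) (extChartAt I p p) :=
  I.uniqueDiffOn _ (Set.mem_range_self _)

theorem differentiableWithinAt_comp_extChartAt_symm {f : M → E} {p : M}
    (hf : MDifferentiableAt I 𝓘(𝕜, E) f p) :
    DifferentiableWithinAt 𝕜 (f ∘ (extChartAt I p).symm) (Set.range I) (extChartAt I p p) :=
  ((mdifferentiableAt_iff f p).1 hf).2

theorem mvfderiv_fderiv_comp {g : E → F} {f : M → E} {p : M}
    (hg : DifferentiableAt 𝕜 g (f p)) (hf : MDifferentiableAt I 𝓘(𝕜, E) f p) :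
    mvfderiv I (fun q => g (f q)) p = fderiv 𝕜 g (f p) ∘L mvfderiv I f p := by
  change mfderiv I 𝓘(𝕜, F) (g ∘ f) p = _
  rw [mfderiv_comp p hg.mdifferentiableAt hf, mfderiv_eq_fderiv]
  rfl

theorem mvfderiv_bilinear (B : E →L[𝕜] F →L[𝕜] G) {f : M → E} {g : M → F} {p : M}
    (hf : MDifferentiableAt I 𝓘(𝕜, E) f p) (hg : MDifferentiableAt I 𝓘(𝕜, F) g p) :
    mvfderiv I (fun q => B (f q) (g q)) p =
      B (f p) ∘L mvfderiv I g p + B.flip (g p) ∘L mvfderiv I f p := by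
  have hBfg : MDifferentiableAt I 𝓘(𝕜, G) (fun q => B (f q) (g q)) p :=
    (B.differentiableAt.comp_mdifferentiableAt hf).clm_apply hg
  have h := B.fderivWithin_of_bilinear (differentiableWithinAt_comp_extChartAt_symm hf)
    (differentiableWithinAt_comp_extChartAt_symm hg) (uniqueDiffWithinAt_range I p)
  simp only [Function.comp_apply, extChartAt_to_inv] at h
  rw [hBfg.mvfderiv, hf.mvfderiv, hg.mvfderiv]
  exact h

variable (I) in
/-- The derivative of `f` read in the preferred chart at `p`, as a function on the coordinate
domain. -/
def chartDeriv (f : M → E) (p : M) : X → X →L[𝕜] E :=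
  fderivWithin 𝕜 (f ∘ (extChartAt I p).symm) (Set.range I)

theorem mvfderiv_eq_chartDeriv {f : M → E} {p : M} (hf : MDifferentiableAt I 𝓘(𝕜, E) f p) :
    mvfderiv I f p = chartDeriv I f p (extChartAt I p p) :=
  hf.mvfderiv

theorem contDiffWithinAt_chartDeriv {m k : WithTop ℕ∞} {f : M → E} {p : M}
    (hf : ContMDiffAt I 𝓘(𝕜, E) k f p) (hm : m + 1 ≤ k) :
    ContDiffWithinAt 𝕜 m (chartDeriv I f p) (Set.range I) (extChartAt I p p) :=
  (contMDiffAt_iff.1 hf).2.fderivWithin_right I.uniqueDiffOn hm (Set.mem_range_self _)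

theorem differentiableWithinAt_chartDeriv {f : M → E} {p : M}
    (hf : ContMDiffAt I 𝓘(𝕜, E) 2 f p) :
    DifferentiableWithinAt 𝕜 (chartDeriv I f p) (Set.range I) (extChartAt I p p) :=
  (contDiffWithinAt_chartDeriv hf one_add_one_eq_two.le).differentiableWithinAt one_ne_zero

variable (I) in
/-- The second derivative of `f` read in the preferred chart at `p`, at the point `p`. -/
def chartHessian (f : M → E) (p : M) : X →L[𝕜] X →L[𝕜] E :=
  fderivWithin 𝕜 (chartDeriv I f p) (Set.range I) (extChartAt I p p)

theorem chartHessian_comm {k : WithTop ℕ∞} {f : M → E} {p : M}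
    (hf : ContMDiffAt I 𝓘(𝕜, E) k f p) (hk : minSmoothness 𝕜 2 ≤ k) (u v : X) :
    chartHessian I f p u v = chartHessian I f p v u :=
  (contMDiffAt_iff.1 hf).2.isSymmSndFDerivWithinAt hk I.uniqueDiffOn
    (I.range_subset_closure_interior (Set.mem_range_self _)) (Set.mem_range_self _) u v

variable [IsManifold I 1 M]

theorem chartDeriv_comp_mvfderiv_extChartAt {f : M → E} {p : M} {x : X}
    (hx : x ∈ (extChartAt I p).target)
    (hf : MDifferentiableAt I 𝓘(𝕜, E) f ((extChartAt I p).symm x)) :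
    chartDeriv I f p x ∘L mvfderiv I (extChartAt I p) ((extChartAt I p).symm x) =
      mvfderiv I f ((extChartAt I p).symm x) := by
  have hchain : chartDeriv I f p x = mfderiv I 𝓘(𝕜, E) f ((extChartAt I p).symm x) ∘L
      mfderivWithin 𝓘(𝕜, X) I (extChartAt I p).symm (Set.range I) x := by
    rw [chartDeriv, ← mfderivWithin_eq_fderivWithin]
    exact mfderiv_comp_mfderivWithin x hf (mdifferentiableWithinAt_extChartAt_symm hx)
      (I.uniqueMDiffOn x (extChartAt_target_subset_range p hx))
  have hinv := mfderivWithin_extChartAt_symm_comp_mfderiv_extChartAt hx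
  refine ContinuousLinearMap.ext fun v => ?_
  rw [hchain]
  exact congrArg (mfderiv I 𝓘(𝕜, E) f _) (congrArg (fun L => L v) hinv)

theorem mvfderiv_extChartAt_surjective {p : M} {x : X} (hx : x ∈ (extChartAt I p).target) :
    Function.Surjective (mvfderiv I (extChartAt I p) ((extChartAt I p).symm x)) :=
  (isInvertible_mfderiv_extChartAt ((extChartAt I p).map_target hx)).bijective.surjective

theorem mvfderiv_extChartAt_self (p : M) (v : TangentSpace I p) :
    mvfderiv I (extChartAt I p) p v = v :=
  congrArg (fun L => L v) (mfderiv_extChartAt_self (I := I) (x := p))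

end ManifoldCalculus

section TangentPlane

variable {H₀ : Type*} [TopologicalSpace H₀] {I : ModelWithCorners ℝ E2 H₀}
  {M : Type*} [TopologicalSpace M] [ChartedSpace H₀ M] {r n : M → E3} {p : M}

instance finiteDimensional_tangentSpace (p : M) : FiniteDimensional ℝ (TangentSpace I p) :=
  (tangentBasis I p).finiteDimensional_of_finite

theorem finrank_tangentSpace (p : M) : Module.finrank ℝ (TangentSpace I p) = 2 := by
  rw [Module.finrank_eq_card_basis (tangentBasis I p), Fintype.card_fin]

theorem metric_apply (p : M) (v w : TangentSpace I p) :
    metric I r p v w = inner ℝ (mvfderiv I r p v) (mvfderiv I r p w) := rfl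

theorem metric_comm (p : M) (v w : TangentSpace I p) : metric I r p v w = metric I r p w v := by
  rw [metric_apply, metric_apply, real_inner_comm]

theorem toMatrix_metric (p : M) :
    LinearMap.toMatrix (tangentBasis I p) (tangentBasis I p).dualBasis (metric I r p) =
      Matrix.of fun i j => metric I r p (tangentBasis I p i) (tangentBasis I p j) := by
  ext i j
  rw [LinearMap.toMatrix_apply, Module.Basis.dualBasis_repr, Matrix.of_apply, metric_comm]

theorem isUnit_det_gram (hr : Function.Injective (mvfderiv I r p)) :
    IsUnit (Matrix.of fun i j =>
      metric I r p (tangentBasis I p i) (tangentBasis I p j)).det := by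
  have hli : LinearIndependent ℝ (fun i => mvfderiv I r p (tangentBasis I p i)) :=
    (tangentBasis I p).linearIndependent.map' (mvfderiv I r p : TangentSpace I p →ₗ[ℝ] E3)
      (LinearMap.ker_eq_bot.2 hr)
  exact (Matrix.posDef_gram_of_linearIndependent hli).det_pos.ne'.isUnit

theorem sharp_metric (hr : Function.Injective (mvfderiv I r p)) (v : TangentSpace I p) :
    sharp I r p (metric I r p v) = v := by
  suffices h : sharp I r p ∘ₗ metric I r p = LinearMap.id from LinearMap.congr_fun h v
  apply (LinearMap.toMatrix (tangentBasis I p) (tangentBasis I p)).injective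
  rw [LinearMap.toMatrix_comp _ (tangentBasis I p).dualBasis, toMatrix_metric, sharp,
    LinearMap.toMatrix_toLin, LinearMap.toMatrix_id, invGram,
    Matrix.nonsing_inv_mul _ (isUnit_det_gram hr)]

theorem tangentialPart_mvfderiv (hr : Function.Injective (mvfderiv I r p))
    (v : TangentSpace I p) : tangentialPart I r p (mvfderiv I r p v) = v :=
  sharp_metric hr v

theorem shape_eq_neg_tangentialPart (p : M) (v : TangentSpace I p) :
    shape I r n p v = -tangentialPart I r p (mvfderiv I n p v) :=
  map_neg (sharp I r p) _

namespace IsImmersionWithNormal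

variable (hrn : IsImmersionWithNormal I r n)
include hrn

theorem mdifferentiableAt_immersion (p : M) : MDifferentiableAt I 𝓘(ℝ, E3) r p :=
  hrn.smooth_immersion.mdifferentiable (by simp) p

theorem mdifferentiableAt_normal (p : M) : MDifferentiableAt I 𝓘(ℝ, E3) n p :=
  hrn.smooth_normal.mdifferentiable (by simp) p

theorem normal_ne_zero (p : M) : n p ≠ 0 :=
  norm_ne_zero_iff.1 ((hrn.norm_normal p).trans_ne one_ne_zero)

theorem inner_normal_mvfderiv (p : M) (v : TangentSpace I p) :
    inner ℝ (n p) (mvfderiv I r p v) = 0 := by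
  rw [real_inner_comm, hrn.orthogonal_normal]

theorem inner_normal_self (p : M) : inner ℝ (n p) (n p) = (1 : ℝ) :=
  inner_self_eq_one_of_norm_eq_one (hrn.norm_normal p)

theorem inner_normal_mvfderiv_normal (p : M) (v : TangentSpace I p) :
    inner ℝ (n p) (mvfderiv I n p v) = 0 := by
  have h : mvfderiv I (fun q => inner ℝ (n q) (n q)) p v =
      inner ℝ (n p) (mvfderiv I n p v) + inner ℝ (mvfderiv I n p v) (n p) :=
    congrArg (fun L => L v) (mvfderiv_bilinear (innerSL ℝ) (hrn.mdifferentiableAt_normal p)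
      (hrn.mdifferentiableAt_normal p))
  rw [funext hrn.inner_normal_self, mvfderiv_const, zero_apply] at h
  linarith [real_inner_comm (n p) (mvfderiv I n p v)]

theorem range_mvfderiv (p : M) :
    LinearMap.range (mvfderiv I r p : TangentSpace I p →ₗ[ℝ] E3) = (ℝ ∙ n p)ᗮ := by
  have : Fact (Module.finrank ℝ E3 = 2 + 1) := ⟨finrank_euclideanSpace_fin⟩
  apply Submodule.eq_of_le_of_finrank_eq
  · rintro _ ⟨v, rfl⟩
    exact Submodule.mem_orthogonal_singleton_iff_inner_right.2 (hrn.inner_normal_mvfderiv p v)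
  · rw [LinearMap.finrank_range_of_inj (hrn.injective_deriv p), finrank_tangentSpace,
      Submodule.finrank_orthogonal_span_singleton (n := 2) (hrn.normal_ne_zero p)]

theorem tangentialPart_normal (p : M) : tangentialPart I r p (n p) = 0 := by
  have h : (innerₗ E3).compl₁₂ LinearMap.id (mvfderiv I r p : TangentSpace I p →ₗ[ℝ] E3) (n p) =
      0 := LinearMap.ext (hrn.inner_normal_mvfderiv p)
  rw [tangentialPart, LinearMap.comp_apply, h, map_zero]

theorem mvfderiv_tangentialPart_of_inner_eq_zero {p : M} {u : E3} (hu : inner ℝ (n p) u = 0) :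
    mvfderiv I r p (tangentialPart I r p u) = u := by
  obtain ⟨v, rfl⟩ : u ∈ LinearMap.range (mvfderiv I r p : TangentSpace I p →ₗ[ℝ] E3) := by
    rwa [hrn.range_mvfderiv, Submodule.mem_orthogonal_singleton_iff_inner_right]
  exact congrArg (mvfderiv I r p) (tangentialPart_mvfderiv (hrn.injective_deriv p) v)

theorem mvfderiv_tangentialPart (p : M) (e : E3) :
    mvfderiv I r p (tangentialPart I r p e) = e - inner ℝ (n p) e • n p := by
  have hperp : inner ℝ (n p) (e - inner ℝ (n p) e • n p) = 0 := by
    rw [inner_sub_right, real_inner_smul_right, hrn.inner_normal_self, mul_one, sub_self]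
  rw [← hrn.mvfderiv_tangentialPart_of_inner_eq_zero hperp, map_sub, map_smul,
    hrn.tangentialPart_normal, smul_zero, sub_zero]

theorem mvfderiv_shape (p : M) (v : TangentSpace I p) :
    mvfderiv I r p (shape I r n p v) = -mvfderiv I n p v := by
  rw [shape_eq_neg_tangentialPart, map_neg,
    hrn.mvfderiv_tangentialPart_of_inner_eq_zero (hrn.inner_normal_mvfderiv_normal p v)]

end IsImmersionWithNormal

end TangentPlane

section TangentialDerivative

variable {H₀ : Type*} [TopologicalSpace H₀] {I : ModelWithCorners ℝ E2 H₀}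
  {M : Type*} [TopologicalSpace M] [ChartedSpace H₀ M]
  {E F G : Type*} [NormedAddCommGroup E] [NormedSpace ℝ E] [NormedAddCommGroup F]
  [NormedSpace ℝ F] [NormedAddCommGroup G] [NormedSpace ℝ G] {r n : M → E3} {p : M}

variable (I) in
/-- The tangential derivative `D f : e ↦ df(e^⊤)` of a function on the surface: its differential,
extended by zero in the normal direction to a linear map on the fixed space `ℝ³`. -/
def tangentialDeriv (r : M → E3) (f : M → E) (p : M) : E3 →L[ℝ] E :=
  mvfderiv I f p ∘L LinearMap.toContinuousLinearMap (tangentialPart I r p)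

theorem tangentialDeriv_apply (f : M → E) (p : M) (e : E3) :
    tangentialDeriv I r f p e = mvfderiv I f p (tangentialPart I r p e) := rfl

theorem tangentialDeriv_mvfderiv (hr : Function.Injective (mvfderiv I r p)) (f : M → E)
    (v : TangentSpace I p) : tangentialDeriv I r f p (mvfderiv I r p v) = mvfderiv I f p v := by
  rw [tangentialDeriv_apply, tangentialPart_mvfderiv hr]

theorem tangentialDeriv_apply_tangentialDeriv (hr : Function.Injective (mvfderiv I r p))
    (f : M → E) (e : E3) :
    tangentialDeriv I r f p (tangentialDeriv I r r p e) = tangentialDeriv I r f p e :=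
  tangentialDeriv_mvfderiv hr f _

theorem tangentialDeriv_const (c : E) (p : M) : tangentialDeriv I r (fun _ => c) p = 0 := by
  rw [tangentialDeriv, mvfderiv_const, ContinuousLinearMap.zero_comp]

theorem tangentialDeriv_neg (f : M → E) (p : M) :
    tangentialDeriv I r (-f) p = -tangentialDeriv I r f p := by
  rw [tangentialDeriv, mvfderiv_neg, ContinuousLinearMap.neg_comp]
  rfl

theorem tangentialDeriv_add {f g : M → E} (hf : MDifferentiableAt I 𝓘(ℝ, E) f p)
    (hg : MDifferentiableAt I 𝓘(ℝ, E) g p) :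
    tangentialDeriv I r (fun q => f q + g q) p =
      tangentialDeriv I r f p + tangentialDeriv I r g p := by
  rw [tangentialDeriv, mvfderiv_fun_add hf hg, ContinuousLinearMap.add_comp]
  rfl

theorem tangentialDeriv_sub {f g : M → E} (hf : MDifferentiableAt I 𝓘(ℝ, E) f p)
    (hg : MDifferentiableAt I 𝓘(ℝ, E) g p) :
    tangentialDeriv I r (fun q => f q - g q) p =
      tangentialDeriv I r f p - tangentialDeriv I r g p := by
  rw [tangentialDeriv, mvfderiv_fun_sub hf hg, ContinuousLinearMap.sub_comp]
  rfl

theorem tangentialDeriv_bilinear (B : E →L[ℝ] F →L[ℝ] G) {f : M → E} {g : M → F}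
    (hf : MDifferentiableAt I 𝓘(ℝ, E) f p) (hg : MDifferentiableAt I 𝓘(ℝ, F) g p) :
    tangentialDeriv I r (fun q => B (f q) (g q)) p =
      B (f p) ∘L tangentialDeriv I r g p + B.flip (g p) ∘L tangentialDeriv I r f p := by
  rw [tangentialDeriv, mvfderiv_bilinear B hf hg, ContinuousLinearMap.add_comp]
  rfl

theorem tangentialDeriv_smul {f : M → ℝ} {g : M → E} (hf : MDifferentiableAt I 𝓘(ℝ, ℝ) f p)
    (hg : MDifferentiableAt I 𝓘(ℝ, E) g p) :
    tangentialDeriv I r (fun q => f q • g q) p =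
      f p • tangentialDeriv I r g p + (tangentialDeriv I r f p).smulRight (g p) :=
  tangentialDeriv_bilinear (ContinuousLinearMap.lsmul ℝ ℝ) hf hg

theorem tangentialDeriv_clm_apply {A : M → E →L[ℝ] F} {g : M → E}
    (hA : MDifferentiableAt I 𝓘(ℝ, E →L[ℝ] F) A p) (hg : MDifferentiableAt I 𝓘(ℝ, E) g p) :
    tangentialDeriv I r (fun q => A q (g q)) p =
      A p ∘L tangentialDeriv I r g p + (tangentialDeriv I r A p).flip (g p) :=
  tangentialDeriv_bilinear (ContinuousLinearMap.id ℝ (E →L[ℝ] F)) hA hg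

theorem tangentialDeriv_clm_apply_const {A : M → E →L[ℝ] F}
    (hA : MDifferentiableAt I 𝓘(ℝ, E →L[ℝ] F) A p) (w : E) :
    tangentialDeriv I r (fun q => A q w) p = (tangentialDeriv I r A p).flip w := by
  rw [tangentialDeriv_clm_apply hA mdifferentiableAt_const, tangentialDeriv_const,
    ContinuousLinearMap.comp_zero, zero_add]

theorem tangentialDeriv_fderiv_comp {g : E → F} {f : M → E} (hg : DifferentiableAt ℝ g (f p))
    (hf : MDifferentiableAt I 𝓘(ℝ, E) f p) :
    tangentialDeriv I r (fun q => g (f q)) p = fderiv ℝ g (f p) ∘L tangentialDeriv I r f p := by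
  rw [tangentialDeriv, mvfderiv_fderiv_comp hg hf, ContinuousLinearMap.comp_assoc]
  rfl

theorem tangentialDeriv_prodMk {f : M → E} {g : M → F} (hf : MDifferentiableAt I 𝓘(ℝ, E) f p)
    (hg : MDifferentiableAt I 𝓘(ℝ, F) g p) :
    tangentialDeriv I r (fun q => (f q, g q)) p =
      (tangentialDeriv I r f p).prod (tangentialDeriv I r g p) := by
  have hfst := tangentialDeriv_fderiv_comp (r := r) differentiableAt_fst (hf.prodMk_space hg)
  have hsnd := tangentialDeriv_fderiv_comp (r := r) differentiableAt_snd (hf.prodMk_space hg)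
  rw [fderiv_fst] at hfst
  rw [fderiv_snd] at hsnd
  rw [hfst, hsnd]
  rfl

theorem mdifferentiableAt_inner_const {f : M → E3} (hf : MDifferentiableAt I 𝓘(ℝ, E3) f p)
    (e : E3) : MDifferentiableAt I 𝓘(ℝ, ℝ) (fun q => inner ℝ (f q) e) p :=
  ((innerSL ℝ).flip e).differentiableAt.comp_mdifferentiableAt hf

theorem tangentialDeriv_inner_const {f : M → E3} (hf : MDifferentiableAt I 𝓘(ℝ, E3) f p)
    (e a : E3) :
    tangentialDeriv I r (fun q => inner ℝ (f q) e) p a = inner ℝ (tangentialDeriv I r f p a) e :=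
  congrArg (· a) ((tangentialDeriv_fderiv_comp ((innerSL ℝ).flip e).differentiableAt hf).trans
    (by rw [ContinuousLinearMap.fderiv]))

variable (I) in
/-- The isomorphism `(u, t) ↦ ∂_u r + t n` of `ℝ² × ℝ` with `ℝ³`, in the preferred chart at `p`. -/
def chartFrame (r n : M → E3) (p : M) (x : E2) : E2 × ℝ →L[ℝ] E3 :=
  (chartDeriv I r p x).coprod (ContinuousLinearMap.toSpanSingleton ℝ (n ((extChartAt I p).symm x)))

theorem IsImmersionWithNormal.contDiffWithinAt_chartFrame (hrn : IsImmersionWithNormal I r n)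
    (p : M) :
    ContDiffWithinAt ℝ ∞ (chartFrame I r n p) (Set.range I) (extChartAt I p p) := by
  have hJ : ContDiffWithinAt ℝ ∞ (chartDeriv I r p) (Set.range I) (extChartAt I p p) :=
    contDiffWithinAt_chartDeriv (hrn.smooth_immersion p) le_rfl
  have hn : ContDiffWithinAt ℝ ∞ (n ∘ (extChartAt I p).symm) (Set.range I) (extChartAt I p p) :=
    (contMDiffAt_iff.1 (hrn.smooth_normal p)).2
  have hsum : chartFrame I r n p = fun x =>
      chartDeriv I r p x ∘L ContinuousLinearMap.fst ℝ E2 ℝ +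
        (ContinuousLinearMap.snd ℝ E2 ℝ).smulRight ((n ∘ (extChartAt I p).symm) x) :=
    funext fun x => (ContinuousLinearMap.comp_fst_add_comp_snd _ _).symm
  rw [hsum]
  exact (hJ.clm_comp contDiffWithinAt_const).add (contDiffWithinAt_const.smulRight hn)

variable [IsManifold I 1 M]

theorem tangentialDeriv_extChartAt_self (p : M) (e : E3) :
    tangentialDeriv I r (extChartAt I p) p e = tangentialPart I r p e :=
  mvfderiv_extChartAt_self p _

theorem tangentialDeriv_eq_chartDeriv_comp {f : M → E} {x : E2}
    (hx : x ∈ (extChartAt I p).target)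
    (hf : MDifferentiableAt I 𝓘(ℝ, E) f ((extChartAt I p).symm x)) :
    tangentialDeriv I r f ((extChartAt I p).symm x) =
      chartDeriv I f p x ∘L tangentialDeriv I r (extChartAt I p) ((extChartAt I p).symm x) := by
  rw [tangentialDeriv, ← chartDeriv_comp_mvfderiv_extChartAt hx hf]
  rfl

theorem tangentialDeriv_eventuallyEq_chartDeriv_comp {f : M → E}
    (hf : MDifferentiable I 𝓘(ℝ, E) f) (p : M) :
    tangentialDeriv I r f ∘ (extChartAt I p).symm
      =ᶠ[nhdsWithin (extChartAt I p p) (Set.range I)] fun x =>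
        chartDeriv I f p x ∘L
          tangentialDeriv I r (extChartAt I p) ((extChartAt I p).symm x) := by
  filter_upwards [extChartAt_target_mem_nhdsWithin p] with x hx using
    tangentialDeriv_eq_chartDeriv_comp hx (hf _)

namespace IsImmersionWithNormal

variable (hrn : IsImmersionWithNormal I r n)
include hrn

theorem tangentialDeriv_extChartAt_chartDeriv {x : E2} (hx : x ∈ (extChartAt I p).target)
    (u : E2) :
    tangentialDeriv I r (extChartAt I p) ((extChartAt I p).symm x) (chartDeriv I r p x u) = u := by
  obtain ⟨v, rfl⟩ := mvfderiv_extChartAt_surjective hx u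
  have hv := congrArg (· v)
    (chartDeriv_comp_mvfderiv_extChartAt hx (hrn.mdifferentiableAt_immersion _))
  exact (congrArg _ hv).trans (tangentialDeriv_mvfderiv (hrn.injective_deriv _) _ v)

theorem inner_normal_chartDeriv {x : E2} (hx : x ∈ (extChartAt I p).target) (u : E2) :
    inner ℝ (n ((extChartAt I p).symm x)) (chartDeriv I r p x u) = 0 := by
  obtain ⟨v, rfl⟩ := mvfderiv_extChartAt_surjective hx u
  have hv := congrArg (· v)
    (chartDeriv_comp_mvfderiv_extChartAt hx (hrn.mdifferentiableAt_immersion _))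
  exact (congrArg _ hv).trans (hrn.inner_normal_mvfderiv _ v)

theorem chartDeriv_tangentialDeriv_extChartAt {x : E2} (hx : x ∈ (extChartAt I p).target)
    (e : E3) :
    chartDeriv I r p x (tangentialDeriv I r (extChartAt I p) ((extChartAt I p).symm x) e) =
      e - inner ℝ (n ((extChartAt I p).symm x)) e • n ((extChartAt I p).symm x) := by
  rw [← hrn.mvfderiv_tangentialPart, ← tangentialDeriv_apply,
    tangentialDeriv_eq_chartDeriv_comp hx (hrn.mdifferentiableAt_immersion _),
    ContinuousLinearMap.comp_apply]

theorem chartFrame_comp_prod {x : E2} (hx : x ∈ (extChartAt I p).target) :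
    chartFrame I r n p x ∘L
      (tangentialDeriv I r (extChartAt I p) ((extChartAt I p).symm x)).prod
        (innerSL ℝ (n ((extChartAt I p).symm x))) = ContinuousLinearMap.id ℝ E3 := by
  refine ContinuousLinearMap.ext fun e => ?_
  rw [chartFrame, ContinuousLinearMap.comp_apply, ContinuousLinearMap.prod_apply,
    ContinuousLinearMap.coprod_apply, hrn.chartDeriv_tangentialDeriv_extChartAt hx]
  exact sub_add_cancel _ _

theorem prod_comp_chartFrame {x : E2} (hx : x ∈ (extChartAt I p).target) :
    (tangentialDeriv I r (extChartAt I p) ((extChartAt I p).symm x)).prod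
      (innerSL ℝ (n ((extChartAt I p).symm x))) ∘L chartFrame I r n p x =
        ContinuousLinearMap.id ℝ (E2 × ℝ) := by
  refine ContinuousLinearMap.ext fun ⟨u, t⟩ => ?_
  have hρn : tangentialDeriv I r (extChartAt I p) ((extChartAt I p).symm x)
      (n ((extChartAt I p).symm x)) = 0 := by
    rw [tangentialDeriv_apply, hrn.tangentialPart_normal, map_zero]
  rw [chartFrame, ContinuousLinearMap.comp_apply, ContinuousLinearMap.coprod_apply,
    ContinuousLinearMap.prod_apply, ContinuousLinearMap.toSpanSingleton_apply, map_add, map_smul,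
    hrn.tangentialDeriv_extChartAt_chartDeriv hx, hρn, map_add, map_smul, innerSL_apply_apply,
    innerSL_apply_apply, hrn.inner_normal_chartDeriv hx, hrn.inner_normal_self, smul_zero,
    add_zero, zero_add, smul_eq_mul, mul_one]
  rfl

theorem contDiffWithinAt_tangentialDeriv_extChartAt (p : M) :
    ContDiffWithinAt ℝ ∞
      (fun x => tangentialDeriv I r (extChartAt I p) ((extChartAt I p).symm x))
      (Set.range I) (extChartAt I p p) := by
  -- `D φ` is a component of the inverse of the frame `chartFrame`, and inversion is smooth.
  have hinv : (chartFrame I r n p (extChartAt I p p)).IsInvertible :=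
    .of_inverse (hrn.chartFrame_comp_prod (mem_extChartAt_target p))
      (hrn.prod_comp_chartFrame (mem_extChartAt_target p))
  have hsmooth : ContDiffWithinAt ℝ ∞ (fun x => ContinuousLinearMap.fst ℝ E2 ℝ ∘L
      (chartFrame I r n p x).inverse) (Set.range I) (extChartAt I p p) :=
    contDiffWithinAt_const.clm_comp (hinv.contDiffAt_map_inverse.comp_contDiffWithinAt _
      (hrn.contDiffWithinAt_chartFrame p))
  have heq {x : E2} (hx : x ∈ (extChartAt I p).target) :
      tangentialDeriv I r (extChartAt I p) ((extChartAt I p).symm x) =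
        ContinuousLinearMap.fst ℝ E2 ℝ ∘L (chartFrame I r n p x).inverse := by
    rw [ContinuousLinearMap.inverse_eq (hrn.chartFrame_comp_prod hx)
      (hrn.prod_comp_chartFrame hx), ContinuousLinearMap.fst_comp_prod]
  refine hsmooth.congr_of_eventuallyEq ?_ (heq (mem_extChartAt_target p))
  filter_upwards [extChartAt_target_mem_nhdsWithin p] with x hx using heq hx

theorem contMDiff_tangentialDeriv {k m : WithTop ℕ∞} {f : M → E} (hf : ContMDiff I 𝓘(ℝ, E) k f)
    (hmk : m + 1 ≤ k) (hm : m ≤ ∞) :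
    ContMDiff I 𝓘(ℝ, E3 →L[ℝ] E) m (tangentialDeriv I r f) := by
  intro p
  have hdiff : MDifferentiable I 𝓘(ℝ, E) f :=
    hf.mdifferentiable (one_ne_zero.bot_lt.trans_le (le_add_self.trans hmk)).ne'
  rw [contMDiffAt_iff_source, contMDiffWithinAt_iff_contDiffWithinAt]
  exact ((contDiffWithinAt_chartDeriv (hf p) hmk).clm_comp
    ((hrn.contDiffWithinAt_tangentialDeriv_extChartAt p).of_le hm)).congr_of_eventuallyEq
      (tangentialDeriv_eventuallyEq_chartDeriv_comp hdiff p)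
      (tangentialDeriv_eq_chartDeriv_comp (mem_extChartAt_target p) (hdiff _))

theorem mdifferentiable_tangentialDeriv {f : M → E} (hf : ContMDiff I 𝓘(ℝ, E) 2 f) :
    MDifferentiable I 𝓘(ℝ, E3 →L[ℝ] E) (tangentialDeriv I r f) :=
  (hrn.contMDiff_tangentialDeriv hf one_add_one_eq_two.le (by simp)).mdifferentiable one_ne_zero

theorem tangentialDeriv_tangentialDeriv {f : M → E} (hf : ContMDiff I 𝓘(ℝ, E) 2 f)
    (p : M) (a b : E3) :
    tangentialDeriv I r (tangentialDeriv I r f) p a b =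
      chartHessian I f p (tangentialDeriv I r (extChartAt I p) p a)
        (tangentialDeriv I r (extChartAt I p) p b) +
      chartDeriv I f p (extChartAt I p p)
        (chartDeriv I (tangentialDeriv I r (extChartAt I p)) p (extChartAt I p p)
          (tangentialDeriv I r (extChartAt I p) p a) b) := by
  have hdiff : MDifferentiable I 𝓘(ℝ, E) f := hf.mdifferentiable two_ne_zero
  have hD := tangentialDeriv_eq_chartDeriv_comp (r := r) (mem_extChartAt_target (I := I) p)
    (hrn.mdifferentiable_tangentialDeriv hf _)
  have hprod := fderivWithin_clm_comp (uniqueDiffWithinAt_range I p)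
    (differentiableWithinAt_chartDeriv (hf p))
    ((hrn.contDiffWithinAt_tangentialDeriv_extChartAt p).differentiableWithinAt (by simp))
  rw [← (tangentialDeriv_eventuallyEq_chartDeriv_comp hdiff p).fderivWithin_eq
    (tangentialDeriv_eq_chartDeriv_comp (mem_extChartAt_target p) (hdiff _))] at hprod
  rw [extChartAt_to_inv] at hD hprod
  rw [hD, add_comm]
  exact congrArg (· (tangentialDeriv I r (extChartAt I p) p a) b) hprod

theorem tangentialDeriv_commutator {f : M → E} (hf : ContMDiff I 𝓘(ℝ, E) 2 f) (p : M)
    (a b : E3) :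
    tangentialDeriv I r (tangentialDeriv I r f) p a b -
        tangentialDeriv I r (tangentialDeriv I r f) p b a =
      tangentialDeriv I r f p (tangentialDeriv I r (tangentialDeriv I r r) p a b -
        tangentialDeriv I r (tangentialDeriv I r r) p b a) := by
  have hr2 : ContMDiff I 𝓘(ℝ, E3) 2 r := hrn.smooth_immersion.of_le ENat.LEInfty.out
  have hDf := tangentialDeriv_eq_chartDeriv_comp (r := r) (mem_extChartAt_target (I := I) p)
    (hf.mdifferentiable two_ne_zero _)
  have hρJ := hrn.tangentialDeriv_extChartAt_chartDeriv (mem_extChartAt_target (I := I) p)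
  rw [extChartAt_to_inv] at hDf hρJ
  rw [hrn.tangentialDeriv_tangentialDeriv hf, hrn.tangentialDeriv_tangentialDeriv hf,
    hrn.tangentialDeriv_tangentialDeriv hr2, hrn.tangentialDeriv_tangentialDeriv hr2,
    chartHessian_comm (hf p) (by simp) (tangentialDeriv I r (extChartAt I p) p a),
    chartHessian_comm (hr2 p) (by simp) (tangentialDeriv I r (extChartAt I p) p a),
    add_sub_add_left_eq_sub, add_sub_add_left_eq_sub, ← map_sub, ← map_sub, hDf,
    ContinuousLinearMap.comp_apply, hρJ]

end IsImmersionWithNormal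

end TangentialDerivative

section LeviCivita

variable {H₀ : Type*} [TopologicalSpace H₀] {I : ModelWithCorners ℝ E2 H₀}
  {M : Type*} [TopologicalSpace M] [ChartedSpace H₀ M]
  {E : Type*} [NormedAddCommGroup E] [NormedSpace ℝ E] {r n : M → E3}

theorem mvfderiv_tangentBasis {f : M → E} {p : M} (hf : MDifferentiableAt I 𝓘(ℝ, E) f p)
    (i : Fin 2) :
    mvfderiv I f p (tangentBasis I p i) =
      chartDeriv I f p (extChartAt I p p) (EuclideanSpace.single i 1) := by
  have hbasis : tangentBasis I p i = (EuclideanSpace.single i (1 : ℝ) : E2) :=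
    EuclideanSpace.basisFun_apply ..
  rw [mvfderiv_eq_chartDeriv hf, hbasis]
  rfl

theorem tangentBasis_repr_tangentialPart (p : M) (w : E3) (k : Fin 2) :
    (tangentBasis I p).repr (tangentialPart I r p w) k =
      ∑ l, invGram I r p k l * inner ℝ w (mvfderiv I r p (tangentBasis I p l)) := by
  rw [tangentialPart, LinearMap.comp_apply, sharp, Matrix.repr_toLin]
  simp only [Matrix.mulVec, dotProduct, Module.Basis.dualBasis_repr]
  rfl

theorem inv_chartMetric_eq_invGram {p : M} (hr : MDifferentiableAt I 𝓘(ℝ, E3) r p) :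
    (Matrix.of fun a b => chartMetric I r p a b (extChartAt I p p))⁻¹ = invGram I r p := by
  rw [invGram]
  congr 1
  ext a b
  simp only [Matrix.of_apply, metric_apply, mvfderiv_tangentBasis hr]
  rfl

theorem coordDeriv_chartMetric {p : M} (hr : ContMDiffAt I 𝓘(ℝ, E3) 2 r p) (i j l : Fin 2) :
    coordDeriv I (chartMetric I r p j l) i (extChartAt I p p) =
      inner ℝ (chartHessian I r p (EuclideanSpace.single i 1) (EuclideanSpace.single j 1))
        (mvfderiv I r p (tangentBasis I p l)) +
      inner ℝ (chartHessian I r p (EuclideanSpace.single i 1) (EuclideanSpace.single l 1))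
        (mvfderiv I r p (tangentBasis I p j)) := by
  have hd (k : Fin 2) : HasFDerivWithinAt (coordDeriv I (r ∘ (extChartAt I p).symm) k)
      ((chartHessian I r p).flip (EuclideanSpace.single k 1)) (Set.range I) (extChartAt I p p) :=
    (ContinuousLinearMap.apply ℝ E3 (EuclideanSpace.single k (1 : ℝ))).hasFDerivAt
      |>.comp_hasFDerivWithinAt _ (differentiableWithinAt_chartDeriv hr).hasFDerivWithinAt
  have hprod := ((hd j).inner ℝ (hd l)).fderivWithin (uniqueDiffWithinAt_range I p)
  have hr1 : MDifferentiableAt I 𝓘(ℝ, E3) r p := hr.mdifferentiableAt two_ne_zero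
  rw [mvfderiv_tangentBasis hr1, mvfderiv_tangentBasis hr1, add_comm,
    real_inner_comm (chartDeriv I r p _ (EuclideanSpace.single j 1))]
  exact congrArg (· (EuclideanSpace.single i 1)) hprod

/-- Gauss's formula. -/
theorem christoffel_eq_tangentialPart {p : M} (hr : ContMDiffAt I 𝓘(ℝ, E3) 2 r p)
    (k i j : Fin 2) :
    christoffel I r p k i j (extChartAt I p p) =
      (tangentBasis I p).repr (tangentialPart I r p (chartHessian I r p
        (EuclideanSpace.single i 1) (EuclideanSpace.single j 1))) k := by
  have hcomm := chartHessian_comm hr (by simp)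
  rw [christoffel, inv_chartMetric_eq_invGram (hr.mdifferentiableAt two_ne_zero),
    tangentBasis_repr_tangentialPart, Finset.mul_sum]
  refine Finset.sum_congr rfl fun l _ => ?_
  rw [coordDeriv_chartMetric hr, coordDeriv_chartMetric hr, coordDeriv_chartMetric hr,
    hcomm (EuclideanSpace.single j 1) (EuclideanSpace.single i 1),
    hcomm (EuclideanSpace.single l 1) (EuclideanSpace.single i 1),
    hcomm (EuclideanSpace.single l 1) (EuclideanSpace.single j 1)]
  ring

theorem tangentBasis_repr_tangentialPart_chartHessian {p : M}
    (hr : ContMDiffAt I 𝓘(ℝ, E3) 2 r p) (i : Fin 2) (u : E2) (k : Fin 2) :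
    (tangentBasis I p).repr (tangentialPart I r p
        (chartHessian I r p (EuclideanSpace.single i 1) u)) k =
      ∑ j, christoffel I r p k i j (extChartAt I p p) * u j := by
  have hu : ∑ j, u j • (EuclideanSpace.single j (1 : ℝ) : E2) = u := by
    simpa using (EuclideanSpace.basisFun (Fin 2) ℝ).sum_repr u
  conv_lhs => rw [← hu]
  simp only [map_sum, map_smul, Finsupp.coe_finsetSum, Finset.sum_apply, Finsupp.smul_apply,
    smul_eq_mul]
  refine Finset.sum_congr rfl fun j _ => ?_
  rw [christoffel_eq_tangentialPart hr, mul_comm]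

variable (I) in
/-- The vector field `X` read in the preferred chart at `p`; its components are `chartField`. -/
def chartVector (X : Π q : M, TangentSpace I q) (p : M) (x : E2) : E2 :=
  mvfderiv I (extChartAt I p) ((extChartAt I p).symm x) (X ((extChartAt I p).symm x))

variable [IsManifold I 1 M]

namespace IsImmersionWithNormal

variable (hrn : IsImmersionWithNormal I r n)
include hrn

theorem differentiableWithinAt_chartVector {X : Π q : M, TangentSpace I q} {p : M}
    (hX : MDifferentiableAt I 𝓘(ℝ, E3) (fun q => mvfderiv I r q (X q)) p) :
    DifferentiableWithinAt ℝ (chartVector I X p) (Set.range I) (extChartAt I p p) := by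
  have hρ : chartVector I X p = fun x =>
      tangentialDeriv I r (extChartAt I p) ((extChartAt I p).symm x)
        (((fun q => mvfderiv I r q (X q)) ∘ (extChartAt I p).symm) x) :=
    funext fun x => (tangentialDeriv_mvfderiv (hrn.injective_deriv _) _ _).symm
  rw [hρ]
  exact ((hrn.contDiffWithinAt_tangentialDeriv_extChartAt p).differentiableWithinAt
    (by simp)).clm_apply (differentiableWithinAt_comp_extChartAt_symm hX)

theorem mvfderiv_mvfderiv_tangentBasis {X : Π q : M, TangentSpace I q} {p : M}
    (hX : MDifferentiableAt I 𝓘(ℝ, E3) (fun q => mvfderiv I r q (X q)) p) (i : Fin 2) :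
    mvfderiv I (fun q => mvfderiv I r q (X q)) p (tangentBasis I p i) =
      chartHessian I r p (EuclideanSpace.single i 1) (chartVector I X p (extChartAt I p p)) +
        chartDeriv I r p (extChartAt I p p)
          (coordDeriv I (chartVector I X p) i (extChartAt I p p)) := by
  have hchart {x : E2} (hx : x ∈ (extChartAt I p).target) :
      ((fun q => mvfderiv I r q (X q)) ∘ (extChartAt I p).symm) x =
        chartDeriv I r p x (chartVector I X p x) :=
    congrArg (· (X ((extChartAt I p).symm x))) (chartDeriv_comp_mvfderiv_extChartAt hx
      (hrn.mdifferentiableAt_immersion _)).symm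
  have hev : (fun q => mvfderiv I r q (X q)) ∘ (extChartAt I p).symm
      =ᶠ[nhdsWithin (extChartAt I p p) (Set.range I)]
        fun x => chartDeriv I r p x (chartVector I X p x) := by
    filter_upwards [extChartAt_target_mem_nhdsWithin p] with x hx using hchart hx
  rw [mvfderiv_tangentBasis hX, chartDeriv, hev.fderivWithin_eq (hchart (mem_extChartAt_target p)),
    fderivWithin_clm_apply (uniqueDiffWithinAt_range I p)
      (differentiableWithinAt_chartDeriv (hrn.smooth_immersion.of_le ENat.LEInfty.out p))
      (hrn.differentiableWithinAt_chartVector hX), add_comm]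
  rfl

theorem tangentBasis_repr_tangentialPart_chartDeriv (p : M) (u : E2) (k : Fin 2) :
    (tangentBasis I p).repr (tangentialPart I r p (chartDeriv I r p (extChartAt I p p) u)) k =
      u k := by
  have h := hrn.tangentialDeriv_extChartAt_chartDeriv (mem_extChartAt_target (I := I) p) u
  rw [extChartAt_to_inv] at h
  rw [← tangentialDeriv_extChartAt_self]
  exact congrArg (· k) h

theorem covDeriv_eq_tangentialPart_comp {X : Π q : M, TangentSpace I q} {p : M}
    (hX : MDifferentiableAt I 𝓘(ℝ, E3) (fun q => mvfderiv I r q (X q)) p) :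
    covDeriv I r X p = tangentialPart I r p ∘ₗ
      (mvfderiv I (fun q => mvfderiv I r q (X q)) p : TangentSpace I p →ₗ[ℝ] E3) := by
  apply (LinearMap.toMatrix (tangentBasis I p) (tangentBasis I p)).injective
  ext k i
  have hcoord : coordDeriv I (chartField I X p k) i (extChartAt I p p) =
      coordDeriv I (chartVector I X p) i (extChartAt I p p) k :=
    congrArg (fun L : E2 →L[ℝ] ℝ => L (EuclideanSpace.single i 1))
      (((EuclideanSpace.proj k : E2 →L[ℝ] ℝ).hasFDerivAt.comp_hasFDerivWithinAt _
        (hrn.differentiableWithinAt_chartVector hX).hasFDerivWithinAt).fderivWithin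
          (uniqueDiffWithinAt_range I p))
  rw [covDeriv, LinearMap.toMatrix_toLin, Matrix.of_apply, LinearMap.toMatrix_apply,
    LinearMap.comp_apply, ContinuousLinearMap.coe_coe, hrn.mvfderiv_mvfderiv_tangentBasis hX,
    map_add, map_add, Finsupp.add_apply, hrn.tangentBasis_repr_tangentialPart_chartDeriv,
    tangentBasis_repr_tangentialPart_chartHessian (hrn.smooth_immersion.of_le ENat.LEInfty.out p),
    hcoord, add_comm]
  rfl

end IsImmersionWithNormal

end LeviCivita

section ShapeOperator

/-- The trace of a continuous endomorphism, as a continuous linear form. -/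
def traceCLM (V : Type*) [NormedAddCommGroup V] [NormedSpace ℝ V] [FiniteDimensional ℝ V] :
    (V →L[ℝ] V) →L[ℝ] ℝ :=
  LinearMap.toContinuousLinearMap (LinearMap.trace ℝ V ∘ₗ ContinuousLinearMap.coeLM ℝ)

theorem traceCLM_apply {V : Type*} [NormedAddCommGroup V] [NormedSpace ℝ V]
    [FiniteDimensional ℝ V] (A : V →L[ℝ] V) :
    traceCLM V A = LinearMap.trace ℝ V (A : V →ₗ[ℝ] V) := rfl

theorem traceCLM_smulRight {V : Type*} [NormedAddCommGroup V] [NormedSpace ℝ V]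
    [FiniteDimensional ℝ V] (ℓ : V →L[ℝ] ℝ) (v : V) : traceCLM V (ℓ.smulRight v) = ℓ v :=
  LinearMap.trace_smulRight (ℓ : V →ₗ[ℝ] ℝ) v

theorem comp_self_of_basis_fin_two {R V : Type*} [CommRing R] [Nontrivial R] [AddCommGroup V]
    [Module R V] (b : Module.Basis (Fin 2) R V) (f : V →ₗ[R] V) :
    f ∘ₗ f = LinearMap.trace R V f • f - LinearMap.det f • LinearMap.id := by
  have : Module.Free R V := .of_basis b
  have : Module.Finite R V := .of_basis b
  have h := f.aeval_self_charpoly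
  rw [← LinearMap.charpoly_toMatrix f b, Matrix.charpoly_fin_two,
    ← LinearMap.trace_eq_matrix_trace, LinearMap.det_toMatrix] at h
  simp only [map_add, map_sub, map_mul, Polynomial.aeval_X, Polynomial.aeval_C,
    Algebra.algebraMap_eq_smul_one, smul_one_mul, pow_two] at h
  rw [sub_add, sub_eq_zero] at h
  exact h

variable {H₀ : Type*} [TopologicalSpace H₀] {I : ModelWithCorners ℝ E2 H₀}
  {M : Type*} [TopologicalSpace M] [ChartedSpace H₀ M] {r n : M → E3} {p : M}
  {E : Type*} [NormedAddCommGroup E] [NormedSpace ℝ E]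

theorem shape_comp_shape (p : M) : shape I r n p ∘ₗ shape I r n p =
    meanCurv I r n p • shape I r n p - gaussCurv I r n p • LinearMap.id :=
  comp_self_of_basis_fin_two (tangentBasis I p) _

variable (I) in
/-- The shape operator as the linear map `A e = -D_{e^⊤} n` of `ℝ³`, zero on the normal line. -/
def ambientShape (r n : M → E3) (p : M) : E3 →L[ℝ] E3 :=
  -tangentialDeriv I r n p

theorem ambientShape_apply (p : M) (e : E3) :
    ambientShape I r n p e = -tangentialDeriv I r n p e := rfl

namespace IsImmersionWithNormal

variable (hrn : IsImmersionWithNormal I r n)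
include hrn

theorem tangentialDeriv_normal_direction (f : M → E) (p : M) :
    tangentialDeriv I r f p (n p) = 0 := by
  rw [tangentialDeriv_apply, hrn.tangentialPart_normal, map_zero]

theorem mvfderiv_shape_tangentialPart (p : M) (e : E3) :
    mvfderiv I r p (shape I r n p (tangentialPart I r p e)) = ambientShape I r n p e := by
  rw [hrn.mvfderiv_shape, ambientShape_apply, tangentialDeriv_apply]

theorem ambientShape_mvfderiv (p : M) (v : TangentSpace I p) :
    ambientShape I r n p (mvfderiv I r p v) = mvfderiv I r p (shape I r n p v) := by
  rw [← hrn.mvfderiv_shape_tangentialPart, tangentialPart_mvfderiv (hrn.injective_deriv p)]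

theorem inner_normal_ambientShape (p : M) (e : E3) :
    inner ℝ (n p) (ambientShape I r n p e) = 0 := by
  rw [← hrn.mvfderiv_shape_tangentialPart, hrn.inner_normal_mvfderiv]

theorem ambientShape_comp_ambientShape (p : M) :
    ambientShape I r n p ∘L ambientShape I r n p =
      meanCurv I r n p • ambientShape I r n p - gaussCurv I r n p • tangentialDeriv I r r p := by
  refine ContinuousLinearMap.ext fun e => ?_
  have hCH := congrArg (mvfderiv I r p)
    (LinearMap.congr_fun (shape_comp_shape (r := r) (n := n) p) (tangentialPart I r p e))
  rw [LinearMap.comp_apply, LinearMap.sub_apply, map_sub, LinearMap.smul_apply,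
    LinearMap.smul_apply, map_smul, map_smul, ← hrn.ambientShape_mvfderiv,
    hrn.mvfderiv_shape_tangentialPart] at hCH
  exact hCH

theorem ambientShape_ambientShape (p : M) (e : E3) :
    ambientShape I r n p (ambientShape I r n p e) =
      meanCurv I r n p • ambientShape I r n p e - gaussCurv I r n p • tangentialDeriv I r r p e :=
  congrArg (· e) (hrn.ambientShape_comp_ambientShape p)

theorem trace_eq_traceCLM {L : TangentSpace I p →ₗ[ℝ] TangentSpace I p} {A : E3 →L[ℝ] E3}
    (h : ∀ e, A e = mvfderiv I r p (L (tangentialPart I r p e))) :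
    LinearMap.trace ℝ _ L = traceCLM E3 A := by
  have hA : (A : E3 →ₗ[ℝ] E3) = (mvfderiv I r p : TangentSpace I p →ₗ[ℝ] E3) ∘ₗ
      (L ∘ₗ tangentialPart I r p) := LinearMap.ext h
  have hL : L = (L ∘ₗ tangentialPart I r p) ∘ₗ
      (mvfderiv I r p : TangentSpace I p →ₗ[ℝ] E3) :=
    LinearMap.ext fun v => congrArg L (tangentialPart_mvfderiv (hrn.injective_deriv p) v).symm
  rw [traceCLM_apply, hA, LinearMap.trace_comp_comm', ← hL]

theorem meanCurv_eq_traceCLM (p : M) : meanCurv I r n p = traceCLM E3 (ambientShape I r n p) :=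
  hrn.trace_eq_traceCLM fun e => (hrn.mvfderiv_shape_tangentialPart p e).symm

theorem trace_shape_comp_shape (p : M) :
    LinearMap.trace ℝ _ (shape I r n p ∘ₗ shape I r n p) =
      traceCLM E3 (ambientShape I r n p ∘L ambientShape I r n p) :=
  hrn.trace_eq_traceCLM fun e => by
    rw [ContinuousLinearMap.comp_apply, LinearMap.comp_apply, ← hrn.ambientShape_mvfderiv,
      hrn.mvfderiv_shape_tangentialPart]

theorem gaussCurv_eq_traceCLM (p : M) : gaussCurv I r n p =
    (1 / 2) * (traceCLM E3 (ambientShape I r n p) ^ 2 -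
      traceCLM E3 (ambientShape I r n p ∘L ambientShape I r n p)) := by
  rw [← hrn.meanCurv_eq_traceCLM, ← hrn.trace_shape_comp_shape, shape_comp_shape, map_sub,
    map_smul, map_smul, LinearMap.trace_id, finrank_tangentSpace, ← meanCurv, smul_eq_mul,
    smul_eq_mul]
  push_cast
  ring

variable [IsManifold I 1 M]

theorem contMDiff_ambientShape : ContMDiff I 𝓘(ℝ, E3 →L[ℝ] E3) ∞ (ambientShape I r n) :=
  (-ContinuousLinearMap.id ℝ (E3 →L[ℝ] E3)).contDiff.comp_contMDiff
    (hrn.contMDiff_tangentialDeriv hrn.smooth_normal (by simp) le_rfl)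

theorem mdifferentiableAt_ambientShape (p : M) :
    MDifferentiableAt I 𝓘(ℝ, E3 →L[ℝ] E3) (ambientShape I r n) p :=
  hrn.contMDiff_ambientShape.mdifferentiable (by simp) p

theorem contMDiff_meanCurv : ContMDiff I 𝓘(ℝ, ℝ) ∞ (meanCurv I r n) := by
  rw [funext hrn.meanCurv_eq_traceCLM]
  exact (traceCLM E3).contDiff.comp_contMDiff hrn.contMDiff_ambientShape

theorem contMDiff_gaussCurv : ContMDiff I 𝓘(ℝ, ℝ) ∞ (gaussCurv I r n) := by
  have hpoly : ContDiff ℝ ∞ fun A : E3 →L[ℝ] E3 =>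
      (1 / 2) * (traceCLM E3 A ^ 2 - traceCLM E3 (A ∘L A)) := by
    fun_prop
  rw [funext hrn.gaussCurv_eq_traceCLM]
  exact hpoly.comp_contMDiff hrn.contMDiff_ambientShape

theorem mdifferentiableAt_meanCurv (p : M) : MDifferentiableAt I 𝓘(ℝ, ℝ) (meanCurv I r n) p :=
  hrn.contMDiff_meanCurv.mdifferentiable (by simp) p

theorem mdifferentiableAt_gaussCurv (p : M) : MDifferentiableAt I 𝓘(ℝ, ℝ) (gaussCurv I r n) p :=
  hrn.contMDiff_gaussCurv.mdifferentiable (by simp) p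

theorem tangentialDeriv_tangentialDeriv_immersion (p : M) (a b : E3) :
    tangentialDeriv I r (tangentialDeriv I r r) p a b =
      inner ℝ (ambientShape I r n p a) b • n p + inner ℝ (n p) b • ambientShape I r n p a := by
  have hn := hrn.mdifferentiableAt_normal p
  have hnb := mdifferentiableAt_inner_const hn b
  have hDr : MDifferentiable I 𝓘(ℝ, E3 →L[ℝ] E3) (tangentialDeriv I r r) :=
    hrn.mdifferentiable_tangentialDeriv (hrn.smooth_immersion.of_le ENat.LEInfty.out)
  have hb : (fun q => tangentialDeriv I r r q b) = fun q => b - inner ℝ (n q) b • n q :=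
    funext fun q => hrn.mvfderiv_tangentialPart q b
  have hD := tangentialDeriv_clm_apply_const (r := r) (hDr p) b
  rw [hb, tangentialDeriv_sub (g := fun q => inner ℝ (n q) b • n q) mdifferentiableAt_const
    (hnb.smul hn), tangentialDeriv_const, tangentialDeriv_smul hnb hn] at hD
  have hDa := congrArg (· a) hD
  simp only [sub_apply, add_apply, smul_apply, ContinuousLinearMap.smulRight_apply, zero_apply,
    tangentialDeriv_inner_const hn, ContinuousLinearMap.flip_apply] at hDa
  rw [← hDa, ambientShape_apply, inner_neg_left]
  module

theorem inner_ambientShape_comm (p : M) (a b : E3) :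
    inner ℝ (ambientShape I r n p a) b = inner ℝ (ambientShape I r n p b) a := by
  have hD (a b : E3) : inner ℝ (ambientShape I r n p a) b =
      inner ℝ (n p) (tangentialDeriv I r (tangentialDeriv I r r) p a b) := by
    rw [hrn.tangentialDeriv_tangentialDeriv_immersion, inner_add_right, real_inner_smul_right,
      real_inner_smul_right, hrn.inner_normal_self, hrn.inner_normal_ambientShape, mul_zero,
      add_zero, mul_one]
  rw [← sub_eq_zero, hD, hD, ← inner_sub_right,
    hrn.tangentialDeriv_commutator (hrn.smooth_immersion.of_le ENat.LEInfty.out),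
    tangentialDeriv_apply, hrn.inner_normal_mvfderiv]

theorem ambientShape_codazzi (p : M) (a b : E3) :
    tangentialDeriv I r (ambientShape I r n) p a b -
        tangentialDeriv I r (ambientShape I r n) p b a =
      inner ℝ (n p) b • ambientShape I r n p (ambientShape I r n p a) -
        inner ℝ (n p) a • ambientShape I r n p (ambientShape I r n p b) := by
  have hA : tangentialDeriv I r (ambientShape I r n) p =
      -tangentialDeriv I r (tangentialDeriv I r n) p :=
    tangentialDeriv_neg (tangentialDeriv I r n) p
  have hcomm := hrn.tangentialDeriv_commutator (hrn.smooth_normal.of_le ENat.LEInfty.out) p a b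
  rw [hrn.tangentialDeriv_tangentialDeriv_immersion, hrn.tangentialDeriv_tangentialDeriv_immersion,
    hrn.inner_ambientShape_comm p a b, add_sub_add_left_eq_sub] at hcomm
  rw [hA, neg_apply, neg_apply, neg_apply, neg_apply, neg_sub_neg, ← neg_sub, hcomm,
    ← ambientShape_apply, map_sub, map_smul, map_smul]

theorem traceCLM_flip_tangentialDeriv_ambientShape (p : M) (w : E3) :
    traceCLM E3 ((tangentialDeriv I r (ambientShape I r n) p).flip w) =
      tangentialDeriv I r (meanCurv I r n) p w +
        inner ℝ (n p) w * traceCLM E3 (ambientShape I r n p ∘L ambientShape I r n p) := by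
  have hcodazzi : (tangentialDeriv I r (ambientShape I r n) p).flip w =
      tangentialDeriv I r (ambientShape I r n) p w +
        (inner ℝ (n p) w • (ambientShape I r n p ∘L ambientShape I r n p) -
          (innerSL ℝ (n p)).smulRight (ambientShape I r n p (ambientShape I r n p w))) :=
    ContinuousLinearMap.ext fun a => sub_eq_iff_eq_add'.1 (hrn.ambientShape_codazzi p a w)
  have hDH : tangentialDeriv I r (meanCurv I r n) p =
      traceCLM E3 ∘L tangentialDeriv I r (ambientShape I r n) p := by
    rw [funext hrn.meanCurv_eq_traceCLM, tangentialDeriv_fderiv_comp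
      (traceCLM E3).differentiableAt (hrn.mdifferentiableAt_ambientShape p),
      ContinuousLinearMap.fderiv]
  rw [hcodazzi, hDH, map_add, map_sub, map_smul, traceCLM_smulRight, innerSL_apply_apply,
    hrn.inner_normal_ambientShape, sub_zero, smul_eq_mul, ContinuousLinearMap.comp_apply]

end IsImmersionWithNormal

end ShapeOperator

section DifferentialOperators

variable {H₀ : Type*} [TopologicalSpace H₀] {I : ModelWithCorners ℝ E2 H₀}
  {M : Type*} [TopologicalSpace M] [ChartedSpace H₀ M] {r n : M → E3} {p : M}

variable (I) in
/-- The divergence `tr (D V)` along the surface of a vector field `V` of `ℝ³`, not necessarily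
tangent to the surface. -/
def ambientDiv (r V : M → E3) (p : M) : ℝ := traceCLM E3 (tangentialDeriv I r V p)

theorem ambientDiv_smul {f : M → ℝ} {V : M → E3} (hf : MDifferentiableAt I 𝓘(ℝ, ℝ) f p)
    (hV : MDifferentiableAt I 𝓘(ℝ, E3) V p) :
    ambientDiv I r (fun q => f q • V q) p =
      f p * ambientDiv I r V p + tangentialDeriv I r f p (V p) := by
  rw [ambientDiv, tangentialDeriv_smul hf hV, map_add, map_smul, traceCLM_smulRight, smul_eq_mul,
    ambientDiv]

theorem ambientDiv_add {V W : M → E3} (hV : MDifferentiableAt I 𝓘(ℝ, E3) V p)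
    (hW : MDifferentiableAt I 𝓘(ℝ, E3) W p) :
    ambientDiv I r (fun q => V q + W q) p = ambientDiv I r V p + ambientDiv I r W p := by
  rw [ambientDiv, tangentialDeriv_add hV hW, map_add, ambientDiv, ambientDiv]

theorem ambientDiv_sub {V W : M → E3} (hV : MDifferentiableAt I 𝓘(ℝ, E3) V p)
    (hW : MDifferentiableAt I 𝓘(ℝ, E3) W p) :
    ambientDiv I r (fun q => V q - W q) p = ambientDiv I r V p - ambientDiv I r W p := by
  rw [ambientDiv, tangentialDeriv_sub hV hW, map_sub, ambientDiv, ambientDiv]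

variable (I) in
/-- The gradient `∇f` as a vector field of `ℝ³`: the vector representing `D f`. -/
def ambientGrad (r : M → E3) (f : M → ℝ) (p : M) : E3 :=
  (InnerProductSpace.toDual ℝ E3).symm (tangentialDeriv I r f p)

theorem inner_ambientGrad (f : M → ℝ) (p : M) (e : E3) :
    inner ℝ (ambientGrad I r f p) e = tangentialDeriv I r f p e :=
  InnerProductSpace.toDual_symm_apply

theorem tangentialPart_ambientGrad (hr : Function.Injective (mvfderiv I r p)) (f : M → ℝ) :
    tangentialPart I r p (ambientGrad I r f p) = grad I r f p :=
  congrArg (sharp I r p) <| LinearMap.ext fun v =>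
    (inner_ambientGrad f p (mvfderiv I r p v)).trans (tangentialDeriv_mvfderiv hr f v)

theorem invGram_transpose (p : M) : (invGram I r p).transpose = invGram I r p := by
  rw [invGram, Matrix.transpose_nonsing_inv]
  congr 1
  ext i j
  exact metric_comm p _ _

theorem formInner_eq_trace (p : M) (A B : TangentSpace I p →ₗ[ℝ] TangentSpace I p →ₗ[ℝ] ℝ) :
    formInner I r p A B =
      LinearMap.trace ℝ _ (sharp I r p ∘ₗ A.flip ∘ₗ sharp I r p ∘ₗ B) := by
  have hG (i k : Fin 2) : invGram I r p i k = invGram I r p k i :=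
    congrFun (congrFun (invGram_transpose p) k) i
  rw [LinearMap.trace_eq_matrix_trace ℝ (tangentBasis I p),
    LinearMap.toMatrix_comp _ (tangentBasis I p).dualBasis,
    LinearMap.toMatrix_comp _ (tangentBasis I p),
    LinearMap.toMatrix_comp _ (tangentBasis I p).dualBasis, sharp, LinearMap.toMatrix_toLin]
  simp only [formInner, Matrix.trace, Matrix.diag_apply, Matrix.mul_apply,
    LinearMap.toMatrix_apply, Module.Basis.dualBasis_repr, LinearMap.flip_apply, Finset.mul_sum]
  simp only [Fin.sum_univ_two, hG 1 0]
  ring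

namespace IsImmersionWithNormal

variable (hrn : IsImmersionWithNormal I r n)
include hrn

theorem inner_normal_ambientGrad (f : M → ℝ) (p : M) :
    inner ℝ (n p) (ambientGrad I r f p) = 0 := by
  rw [real_inner_comm, inner_ambientGrad, hrn.tangentialDeriv_normal_direction]

theorem mvfderiv_grad (f : M → ℝ) (p : M) :
    mvfderiv I r p (grad I r f p) = ambientGrad I r f p := by
  rw [← tangentialPart_ambientGrad (hrn.injective_deriv p),
    hrn.mvfderiv_tangentialPart_of_inner_eq_zero (hrn.inner_normal_ambientGrad f p)]

variable [IsManifold I 1 M]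

theorem mdifferentiableAt_ambientGrad {f : M → ℝ} (hf : ContMDiff I 𝓘(ℝ, ℝ) 2 f) (p : M) :
    MDifferentiableAt I 𝓘(ℝ, E3) (ambientGrad I r f) p :=
  let L : (E3 →L[ℝ] ℝ) →L[ℝ] E3 :=
    ((InnerProductSpace.toDual ℝ E3).symm.toContinuousLinearEquiv : (E3 →L[ℝ] ℝ) →L⋆[ℝ] E3)
  L.differentiableAt.comp_mdifferentiableAt (hrn.mdifferentiable_tangentialDeriv hf p)

theorem secondForm_flip (p : M) : (secondForm I r n p).flip = secondForm I r n p := by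
  have h (v w : TangentSpace I p) : secondForm I r n p v w =
      inner ℝ (ambientShape I r n p (mvfderiv I r p v)) (mvfderiv I r p w) := by
    rw [hrn.ambientShape_mvfderiv, hrn.mvfderiv_shape, inner_neg_left]
    rfl
  ext v w
  rw [LinearMap.flip_apply, h, h, hrn.inner_ambientShape_comm]

theorem formInner_secondForm (p : M) (B : TangentSpace I p →ₗ[ℝ] TangentSpace I p →ₗ[ℝ] ℝ) :
    formInner I r p (secondForm I r n p) B =
      LinearMap.trace ℝ _ (shape I r n p ∘ₗ sharp I r p ∘ₗ B) := by
  rw [formInner_eq_trace, hrn.secondForm_flip, shape, LinearMap.comp_assoc]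

theorem formInner_secondForm_self (p : M) :
    formInner I r p (secondForm I r n p) (secondForm I r n p) =
      traceCLM E3 (ambientShape I r n p ∘L ambientShape I r n p) := by
  rw [hrn.formInner_secondForm, ← shape, hrn.trace_shape_comp_shape]

theorem divergence_eq_ambientDiv {X : Π q : M, TangentSpace I q} {V : M → E3}
    (hXV : ∀ q, mvfderiv I r q (X q) = V q) (hV : MDifferentiableAt I 𝓘(ℝ, E3) V p) :
    divergence I r X p = ambientDiv I r V p := by
  obtain rfl : (fun q => mvfderiv I r q (X q)) = V := funext hXV
  rw [divergence, hrn.covDeriv_eq_tangentialPart_comp hV, LinearMap.trace_comp_comm']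
  rfl

theorem laplacian_eq_ambientDiv {f : M → ℝ} (hf : ContMDiff I 𝓘(ℝ, ℝ) 2 f) (p : M) :
    laplacian I r f p = ambientDiv I r (ambientGrad I r f) p :=
  hrn.divergence_eq_ambientDiv (hrn.mvfderiv_grad f) (hrn.mdifferentiableAt_ambientGrad hf p)

theorem formInner_secondForm_hess {f : M → ℝ} (hf : ContMDiff I 𝓘(ℝ, ℝ) 2 f) (p : M) :
    formInner I r p (secondForm I r n p) (hess I r f p) =
      traceCLM E3 (ambientShape I r n p ∘L tangentialDeriv I r (ambientGrad I r f) p) := by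
  have hG := hrn.mdifferentiableAt_ambientGrad hf p
  rw [← funext (hrn.mvfderiv_grad f)] at hG ⊢
  have hsharp : sharp I r p ∘ₗ hess I r f p = covDeriv I r (grad I r f) p :=
    LinearMap.ext fun v => sharp_metric (hrn.injective_deriv p) _
  rw [hrn.formInner_secondForm, hsharp, hrn.covDeriv_eq_tangentialPart_comp hG]
  exact hrn.trace_eq_traceCLM fun e => (hrn.mvfderiv_shape_tangentialPart p _).symm

theorem ambientDiv_ambientShape_apply {V : M → E3} (hV : MDifferentiableAt I 𝓘(ℝ, E3) V p) :
    ambientDiv I r (fun q => ambientShape I r n q (V q)) p =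
      traceCLM E3 (ambientShape I r n p ∘L tangentialDeriv I r V p) +
        (tangentialDeriv I r (meanCurv I r n) p (V p) +
          inner ℝ (n p) (V p) * formInner I r p (secondForm I r n p) (secondForm I r n p)) := by
  rw [ambientDiv, tangentialDeriv_clm_apply (hrn.mdifferentiableAt_ambientShape p) hV, map_add,
    hrn.traceCLM_flip_tangentialDeriv_ambientShape, hrn.formInner_secondForm_self]

theorem ambientDiv_tangentialDeriv_immersion (p : M) (e : E3) :
    ambientDiv I r (fun q => tangentialDeriv I r r q e) p =
      meanCurv I r n p * inner ℝ (n p) e := by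
  have hDr : MDifferentiable I 𝓘(ℝ, E3 →L[ℝ] E3) (tangentialDeriv I r r) :=
    hrn.mdifferentiable_tangentialDeriv (hrn.smooth_immersion.of_le ENat.LEInfty.out)
  have hD2r : (tangentialDeriv I r (tangentialDeriv I r r) p).flip e =
      ((innerSL ℝ).flip e ∘L ambientShape I r n p).smulRight (n p) +
        inner ℝ (n p) e • ambientShape I r n p :=
    ContinuousLinearMap.ext fun a => hrn.tangentialDeriv_tangentialDeriv_immersion p a e
  have hAn : ambientShape I r n p (n p) = 0 := by
    rw [ambientShape_apply, hrn.tangentialDeriv_normal_direction, neg_zero]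
  rw [ambientDiv, tangentialDeriv_clm_apply_const (hDr p), hD2r, map_add, map_smul,
    traceCLM_smulRight, ContinuousLinearMap.comp_apply, hAn, map_zero, zero_add,
    ← hrn.meanCurv_eq_traceCLM, smul_eq_mul, mul_comm]

end IsImmersionWithNormal

end DifferentialOperators

section Lagrangian

variable {H₀ : Type*} [TopologicalSpace H₀] {I : ModelWithCorners ℝ E2 H₀}
  {M : Type*} [TopologicalSpace M] [ChartedSpace H₀ M] {r n : M → E3} {p : M} {F : ℝ × ℝ → ℝ}

variable (I) in
/-- The pair `(H, K)` along the surface, at which the Lagrangian `F` is evaluated. -/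
def curvatures (r n : M → E3) (p : M) : ℝ × ℝ := (meanCurv I r n p, gaussCurv I r n p)

theorem lagrH_eq_fderiv (hF : DifferentiableAt ℝ F (curvatures I r n p)) :
    lagrH I r n F p = fderiv ℝ F (curvatures I r n p) (1, 0) :=
  (hF.hasFDerivAt.comp_hasDerivAt (meanCurv I r n p)
    ((hasDerivAt_id _).prodMk (hasDerivAt_const _ (gaussCurv I r n p)))).deriv

theorem lagrK_eq_fderiv (hF : DifferentiableAt ℝ F (curvatures I r n p)) :
    lagrK I r n F p = fderiv ℝ F (curvatures I r n p) (0, 1) :=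
  (hF.hasFDerivAt.comp_hasDerivAt (gaussCurv I r n p)
    ((hasDerivAt_const _ (meanCurv I r n p)).prodMk (hasDerivAt_id _))).deriv

theorem fderiv_curvatures_eq (hF : DifferentiableAt ℝ F (curvatures I r n p)) (x : ℝ × ℝ) :
    fderiv ℝ F (curvatures I r n p) x = lagrH I r n F p * x.1 + lagrK I r n F p * x.2 := by
  have hx : x = x.1 • ((1 : ℝ), (0 : ℝ)) + x.2 • ((0 : ℝ), (1 : ℝ)) := by simp
  rw [hx, map_add, map_smul, map_smul, ← lagrH_eq_fderiv hF, ← lagrK_eq_fderiv hF]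
  simp [mul_comm]

namespace IsImmersionWithNormal

variable (hrn : IsImmersionWithNormal I r n) [IsManifold I 1 M]
include hrn

theorem contMDiff_curvatures : ContMDiff I 𝓘(ℝ, ℝ × ℝ) ∞ (curvatures I r n) :=
  hrn.contMDiff_meanCurv.prodMk_space hrn.contMDiff_gaussCurv

theorem mdifferentiableAt_curvatures (p : M) :
    MDifferentiableAt I 𝓘(ℝ, ℝ × ℝ) (curvatures I r n) p :=
  hrn.contMDiff_curvatures.mdifferentiableAt (by simp)

theorem contMDiff_fderiv_curvatures {m : ℕ∞}
    (hF : ∀ q : M, ContDiffAt ℝ (m + 1) F (curvatures I r n q)) (x : ℝ × ℝ) :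
    ContMDiff I 𝓘(ℝ, ℝ) m (fun q => fderiv ℝ F (curvatures I r n q) x) := fun q =>
  (((hF q).fderiv_right le_rfl).clm_apply contDiffAt_const).comp_contMDiffAt
    ((hrn.contMDiff_curvatures q).of_le (mod_cast le_top))

theorem contMDiff_lagrH {m : ℕ∞} (hF : ∀ q : M, ContDiffAt ℝ (m + 1) F (curvatures I r n q)) :
    ContMDiff I 𝓘(ℝ, ℝ) m (lagrH I r n F) :=
  (hrn.contMDiff_fderiv_curvatures hF (1, 0)).congr fun q =>
    lagrH_eq_fderiv ((hF q).differentiableAt (by simp))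

theorem contMDiff_lagrK {m : ℕ∞} (hF : ∀ q : M, ContDiffAt ℝ (m + 1) F (curvatures I r n q)) :
    ContMDiff I 𝓘(ℝ, ℝ) m (lagrK I r n F) :=
  (hrn.contMDiff_fderiv_curvatures hF (0, 1)).congr fun q =>
    lagrK_eq_fderiv ((hF q).differentiableAt (by simp))

theorem mdifferentiableAt_lagr (hF : DifferentiableAt ℝ F (curvatures I r n p)) :
    MDifferentiableAt I 𝓘(ℝ, ℝ) (lagr I r n F) p :=
  hF.comp_mdifferentiableAt (hrn.mdifferentiableAt_curvatures p)

theorem tangentialDeriv_lagr (hF : DifferentiableAt ℝ F (curvatures I r n p)) (e : E3) :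
    tangentialDeriv I r (lagr I r n F) p e =
      lagrH I r n F p * tangentialDeriv I r (meanCurv I r n) p e +
        lagrK I r n F p * tangentialDeriv I r (gaussCurv I r n) p e := by
  have hD : tangentialDeriv I r (curvatures I r n) p = _ :=
    tangentialDeriv_prodMk (hrn.mdifferentiableAt_meanCurv p) (hrn.mdifferentiableAt_gaussCurv p)
  have hcomp : tangentialDeriv I r (lagr I r n F) p =
      fderiv ℝ F (curvatures I r n p) ∘L tangentialDeriv I r (curvatures I r n) p :=
    tangentialDeriv_fderiv_comp hF (hrn.mdifferentiableAt_curvatures p)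
  rw [hcomp, hD]
  exact fderiv_curvatures_eq hF _

end IsImmersionWithNormal

end Lagrangian

section StressTensor

variable {H₀ : Type*} [TopologicalSpace H₀] {I : ModelWithCorners ℝ E2 H₀}
  {M : Type*} [TopologicalSpace M] [ChartedSpace H₀ M] {r n : M → E3} {p : M} {a b : M → ℝ}
  {F : ℝ × ℝ → ℝ}

variable (I) in
/-- The vector field `S(∇b) - ∇a - H ∇b` of `ℝ³`. For `a = F_H` and `b = F_K` it is the normal
component of the stress tensor, that is, its value on `n`. -/
def normalFlux (r n : M → E3) (a b : M → ℝ) (p : M) : E3 :=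
  ambientShape I r n p (ambientGrad I r b p) - ambientGrad I r a p -
    meanCurv I r n p • ambientGrad I r b p

namespace IsImmersionWithNormal

variable (hrn : IsImmersionWithNormal I r n)
include hrn

theorem mvfderiv_stress (F : ℝ × ℝ → ℝ) (p : M) (e : E3) :
    mvfderiv I r p (stress I r n F p e) =
      (lagr I r n F p - gaussCurv I r n p * lagrK I r n F p) • tangentialDeriv I r r p e -
        lagrH I r n F p • ambientShape I r n p e +
          inner ℝ (n p) e • normalFlux I r n (lagrH I r n F) (lagrK I r n F) p := by
  have hS (v : TangentSpace I p) :
      mvfderiv I r p (shape I r n p v) = ambientShape I r n p (mvfderiv I r p v) := by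
    rw [hrn.ambientShape_mvfderiv]
  have hSt : mvfderiv I r p (shape I r n p (tangentialPart I r p e)) = ambientShape I r n p e :=
    hrn.mvfderiv_shape_tangentialPart p e
  simp only [stress, LinearMap.add_apply, LinearMap.sub_apply, LinearMap.smul_apply,
    LinearMap.comp_apply, LinearMap.smulRight_apply, innerₗ_apply_apply, map_add, map_sub, map_smul,
    hS (shape I r n p _), hS (grad I r _ p), hSt, hrn.ambientShape_ambientShape,
    hrn.mvfderiv_grad, normalFlux, ← tangentialDeriv_apply]
  module

variable [IsManifold I 1 M]

theorem mdifferentiableAt_tangentialDeriv_immersion_apply (p : M) (e : E3) :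
    MDifferentiableAt I 𝓘(ℝ, E3) (fun q => tangentialDeriv I r r q e) p :=
  (hrn.mdifferentiable_tangentialDeriv
    (hrn.smooth_immersion.of_le ENat.LEInfty.out) p).clm_apply mdifferentiableAt_const

theorem mdifferentiableAt_normalFlux (ha : ContMDiff I 𝓘(ℝ, ℝ) 2 a) (hb : ContMDiff I 𝓘(ℝ, ℝ) 2 b)
    (p : M) : MDifferentiableAt I 𝓘(ℝ, E3) (normalFlux I r n a b) p :=
  (((hrn.mdifferentiableAt_ambientShape p).clm_apply (hrn.mdifferentiableAt_ambientGrad hb p)).sub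
    (hrn.mdifferentiableAt_ambientGrad ha p)).sub
      ((hrn.mdifferentiableAt_meanCurv p).smul (hrn.mdifferentiableAt_ambientGrad hb p))

theorem ambientDiv_smul_tangentialDeriv_immersion (ha : MDifferentiableAt I 𝓘(ℝ, ℝ) a p) (e : E3) :
    ambientDiv I r (fun q => a q • tangentialDeriv I r r q e) p =
      tangentialDeriv I r a p e + a p * (meanCurv I r n p * inner ℝ (n p) e) := by
  rw [ambientDiv_smul ha (hrn.mdifferentiableAt_tangentialDeriv_immersion_apply p e),
    hrn.ambientDiv_tangentialDeriv_immersion, tangentialDeriv_apply r,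
    tangentialDeriv_mvfderiv (hrn.injective_deriv p), ← tangentialDeriv_apply, add_comm]

theorem ambientDiv_smul_ambientShape (ha : MDifferentiableAt I 𝓘(ℝ, ℝ) a p) (e : E3) :
    ambientDiv I r (fun q => a q • ambientShape I r n q e) p =
      tangentialDeriv I r a p (ambientShape I r n p e) +
        a p * (tangentialDeriv I r (meanCurv I r n) p e +
          inner ℝ (n p) e * formInner I r p (secondForm I r n p) (secondForm I r n p)) := by
  rw [ambientDiv_smul ha ((hrn.mdifferentiableAt_ambientShape p).clm_apply mdifferentiableAt_const),
    hrn.ambientDiv_ambientShape_apply mdifferentiableAt_const, tangentialDeriv_const,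
    ContinuousLinearMap.comp_zero, map_zero, zero_add, add_comm]

theorem inner_normalFlux_ambientShape (a b : M → ℝ) (p : M) (e : E3) :
    inner ℝ (normalFlux I r n a b p) (ambientShape I r n p e) =
      -(gaussCurv I r n p * tangentialDeriv I r b p e) -
        tangentialDeriv I r a p (ambientShape I r n p e) := by
  rw [normalFlux, inner_sub_left, inner_sub_left, real_inner_smul_left,
    hrn.inner_ambientShape_comm, real_inner_comm, inner_ambientGrad, inner_ambientGrad,
    inner_ambientGrad, hrn.ambientShape_ambientShape, map_sub, map_smul, map_smul,
    tangentialDeriv_apply_tangentialDeriv (hrn.injective_deriv p), smul_eq_mul, smul_eq_mul]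
  ring

theorem ambientDiv_normalFlux (ha : ContMDiff I 𝓘(ℝ, ℝ) 2 a) (hb : ContMDiff I 𝓘(ℝ, ℝ) 2 b)
    (p : M) :
    ambientDiv I r (normalFlux I r n a b) p =
      formInner I r p (secondForm I r n p) (hess I r b p) - laplacian I r a p -
        meanCurv I r n p * laplacian I r b p := by
  have hA := hrn.mdifferentiableAt_ambientShape p
  have hH := hrn.mdifferentiableAt_meanCurv p
  have hGa := hrn.mdifferentiableAt_ambientGrad ha p
  have hGb := hrn.mdifferentiableAt_ambientGrad hb p
  have hAGb := hA.clm_apply hGb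
  have hsub : ambientDiv I r (normalFlux I r n a b) p =
      ambientDiv I r (fun q => ambientShape I r n q (ambientGrad I r b q)) p -
        ambientDiv I r (ambientGrad I r a) p -
          ambientDiv I r (fun q => meanCurv I r n q • ambientGrad I r b q) p :=
    (ambientDiv_sub (hAGb.sub hGa) (hH.smul hGb)).trans
      (congrArg (· - _) (ambientDiv_sub hAGb hGa))
  rw [hsub, hrn.ambientDiv_ambientShape_apply hGb, ambientDiv_smul hH hGb,
    hrn.formInner_secondForm_hess hb, hrn.laplacian_eq_ambientDiv ha,
    hrn.laplacian_eq_ambientDiv hb, hrn.inner_normal_ambientGrad]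
  ring

theorem ambientDiv_inner_normal_smul {V : M → E3} (hV : MDifferentiableAt I 𝓘(ℝ, E3) V p)
    (e : E3) :
    ambientDiv I r (fun q => (inner ℝ (n q) e : ℝ) • V q) p =
      inner ℝ (n p) e * ambientDiv I r V p - inner ℝ (V p) (ambientShape I r n p e) := by
  have hn := hrn.mdifferentiableAt_normal p
  rw [ambientDiv_smul (mdifferentiableAt_inner_const hn e) hV, tangentialDeriv_inner_const hn,
    real_inner_comm (ambientShape I r n p e), hrn.inner_ambientShape_comm, ambientShape_apply,
    inner_neg_left, sub_neg_eq_add]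

theorem tangentialDeriv_lagr_sub_gaussCurv_mul_lagrK
    (hF : DifferentiableAt ℝ F (curvatures I r n p))
    (hFK : MDifferentiableAt I 𝓘(ℝ, ℝ) (lagrK I r n F) p) (e : E3) :
    tangentialDeriv I r (fun q => lagr I r n F q - gaussCurv I r n q * lagrK I r n F q) p e =
      lagrH I r n F p * tangentialDeriv I r (meanCurv I r n) p e -
        gaussCurv I r n p * tangentialDeriv I r (lagrK I r n F) p e := by
  have hK := hrn.mdifferentiableAt_gaussCurv p
  have hsub : tangentialDeriv I r
      (fun q => lagr I r n F q - gaussCurv I r n q * lagrK I r n F q) p =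
        tangentialDeriv I r (lagr I r n F) p -
          (gaussCurv I r n p • tangentialDeriv I r (lagrK I r n F) p +
            (tangentialDeriv I r (gaussCurv I r n) p).smulRight (lagrK I r n F p)) :=
    (tangentialDeriv_sub (hrn.mdifferentiableAt_lagr hF) (hK.smul hFK)).trans
      (congrArg (_ - ·) (tangentialDeriv_smul hK hFK))
  simp only [hsub, sub_apply, add_apply, smul_apply, ContinuousLinearMap.smulRight_apply,
    hrn.tangentialDeriv_lagr hF, smul_eq_mul]
  ring

theorem divergence_stress (hF : DifferentiableAt ℝ F (curvatures I r n p))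
    (hFH : ContMDiff I 𝓘(ℝ, ℝ) 2 (lagrH I r n F)) (hFK : ContMDiff I 𝓘(ℝ, ℝ) 2 (lagrK I r n F))
    (e : E3) :
    divergence I r (fun q => stress I r n F q e) p =
      -(eulerLagrange I r n F p * inner ℝ (n p) e) := by
  have ha := hFH.mdifferentiableAt two_ne_zero (x := p)
  have hb := hFK.mdifferentiableAt two_ne_zero (x := p)
  have hZ := hrn.mdifferentiableAt_normalFlux hFH hFK p
  have hc : MDifferentiableAt I 𝓘(ℝ, ℝ)
      (fun q => lagr I r n F q - gaussCurv I r n q * lagrK I r n F q) p :=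
    (hrn.mdifferentiableAt_lagr hF).sub ((hrn.mdifferentiableAt_gaussCurv p).smul hb)
  have hcDr := hc.smul (hrn.mdifferentiableAt_tangentialDeriv_immersion_apply p e)
  have haA := ha.smul
    ((hrn.mdifferentiableAt_ambientShape p).clm_apply (mdifferentiableAt_const (c := e)))
  have hnZ := (mdifferentiableAt_inner_const (hrn.mdifferentiableAt_normal p) e).smul hZ
  have hsplit : divergence I r (fun q => stress I r n F q e) p =
      ambientDiv I r (fun q => (lagr I r n F q - gaussCurv I r n q * lagrK I r n F q) •
          tangentialDeriv I r r q e) p -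
        ambientDiv I r (fun q => lagrH I r n F q • ambientShape I r n q e) p +
          ambientDiv I r (fun q => (inner ℝ (n q) e : ℝ) •
            normalFlux I r n (lagrH I r n F) (lagrK I r n F) q) p :=
    (hrn.divergence_eq_ambientDiv (hrn.mvfderiv_stress F · e) ((hcDr.sub haA).add hnZ)).trans <|
      (ambientDiv_add (hcDr.sub haA) hnZ).trans (congrArg (· + _) (ambientDiv_sub hcDr haA))
  rw [hsplit, hrn.ambientDiv_smul_tangentialDeriv_immersion hc,
    hrn.tangentialDeriv_lagr_sub_gaussCurv_mul_lagrK hF hb, hrn.ambientDiv_smul_ambientShape ha,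
    hrn.ambientDiv_inner_normal_smul hZ, hrn.inner_normalFlux_ambientShape,
    hrn.ambientDiv_normalFlux hFH hFK, eulerLagrange]
  ring

theorem tensorDiv_stress (hF : DifferentiableAt ℝ F (curvatures I r n p))
    (hFH : ContMDiff I 𝓘(ℝ, ℝ) 2 (lagrH I r n F))
    (hFK : ContMDiff I 𝓘(ℝ, ℝ) 2 (lagrK I r n F)) :
    tensorDiv I r (stress I r n F) p = -(eulerLagrange I r n F p • n p) := by
  have hn : ∑ i, inner ℝ (n p) (EuclideanSpace.single i 1) • EuclideanSpace.single i (1 : ℝ) =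
      n p := by
    simpa only [EuclideanSpace.basisFun_apply, real_inner_comm] using
      (EuclideanSpace.basisFun (Fin 3) ℝ).sum_repr' (n p)
  simp only [tensorDiv, hrn.divergence_stress hF hFH hFK, neg_smul, mul_smul,
    Finset.sum_neg_distrib, ← Finset.smul_sum, hn]

end IsImmersionWithNormal

end StressTensor

end ImmersedSurface

end

theorem theorem3p3_general
    {H₀ : Type*} [TopologicalSpace H₀] (I : ModelWithCorners ℝ ImmersedSurface.E2 H₀)
    {M : Type*} [TopologicalSpace M] [ChartedSpace H₀ M] [IsManifold I 1 M]
    (r n : M → ImmersedSurface.E3) (hrn : ImmersedSurface.IsImmersionWithNormal I r n)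
    (F : ℝ × ℝ → ℝ)
    (hF : ∀ p : M, ContDiffAt ℝ 3 F
      (ImmersedSurface.meanCurv I r n p, ImmersedSurface.gaussCurv I r n p)) :
    (∀ p : M, ImmersedSurface.tensorDiv I r (ImmersedSurface.stress I r n F) p
        = -(ImmersedSurface.eulerLagrange I r n F p • n p)) ∧
    (ImmersedSurface.IsWSurface I r n F ↔
      ∀ p : M, ImmersedSurface.tensorDiv I r (ImmersedSurface.stress I r n F) p = 0) := by
  have hF' : ∀ p : M, ContDiffAt ℝ ((2 : ℕ∞) + 1) F (ImmersedSurface.curvatures I r n p) :=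
    fun p => (hF p).of_le two_add_one_eq_three.le
  have hdiv (p : M) : ImmersedSurface.tensorDiv I r (ImmersedSurface.stress I r n F) p =
      -(ImmersedSurface.eulerLagrange I r n F p • n p) :=
    hrn.tensorDiv_stress ((hF p).differentiableAt three_ne_zero) (hrn.contMDiff_lagrH hF')
      (hrn.contMDiff_lagrK hF')
  refine ⟨hdiv, forall_congr' fun p => ?_⟩
  rw [hdiv, neg_eq_zero, smul_eq_zero_iff_left (hrn.normal_ne_zero p)]

theorem theorem3p3
    {H₀ : Type*} [TopologicalSpace H₀] (I : ModelWithCorners ℝ ImmersedSurface.E2 H₀)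
    {M : Type*} [TopologicalSpace M] [ChartedSpace H₀ M] [IsManifold I ∞ M]
    (r n : M → ImmersedSurface.E3) (hrn : ImmersedSurface.IsImmersionWithNormal I r n)
    (U : Set (ℝ × ℝ)) (hU : IsOpen U) (F : ℝ × ℝ → ℝ) (hF : ContDiffOn ℝ ∞ F U)
    (hHK : ∀ p : M,
      (ImmersedSurface.meanCurv I r n p, ImmersedSurface.gaussCurv I r n p) ∈ U) :
    (∀ p : M, ImmersedSurface.tensorDiv I r (ImmersedSurface.stress I r n F) p
        = -(ImmersedSurface.eulerLagrange I r n F p • n p)) ∧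
    (ImmersedSurface.IsWSurface I r n F ↔
      ∀ p : M, ImmersedSurface.tensorDiv I r (ImmersedSurface.stress I r n F) p = 0) :=
  theorem3p3_general I r n hrn F fun p =>
    (hF.contDiffAt (hU.mem_nhds (hHK p))).of_le ENat.LEInfty.out
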